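/- Let $M$ be a connected smooth manifold of dimension $n\ge 3$, and let $A\subseteq TM\setminus\mathbf 0$ be open, conic ($\lambda v\in A$ for $v\in A$, $\lambda>0$), with $\pi(A)=M$. Write $\overline A$ for the closure of $A$ in $TM\setminus\mathbf 0$, $\partial A=\overline A\setminus A$, $(x^i,y^i)$ for natural coordinates on $TM$, $\partial_i=\partial/\partial x^i$, and $f_{\cdot i}=\partial f/\partial y^i$. Let $L:A\to\mathbb R$ be a properly Lorentz–Finsler metric, that is: $L$ is smooth and positively $2$-homogeneous; its fundamental tensor $g_{ij}=\frac12L_{\cdot i\cdot j}$ is non-degenerate with signature $(+,-,\dots,-)$; every fiber $A_p=A\cap T_pM$ is connected; $L>0$ on $A$; and $L$ extends smoothly to $\overline A$ with $L=0$ and $g$ non-degenerate on $\partial A$. Put $y_i=g_{ia}y^a$, $$C_{ijk}=\tfrac12 g_{ij\cdot k},\quad C_i=g^{ab}C_{abi},\quad (G^L)^i=\tfrac14 g^{ia}(2\partial_c g_{ab}-\partial_a g_{bc})y^by^c,\quad (N^L)_i^k=(G^L)^k_{\cdot i},$$ $$\mathrm{Lan}_{ijk}=\tfrac12\Big(\partial_k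 g_{ij}-(N^L)_k^a\,g_{ij\cdot a}-(N^L)^a_{k\cdot i}\,g_{aj}-(N^L)^a_{k\cdot j}\,g_{ia}\Big),\qquad \mathrm{Lan}_i=g^{ab}\mathrm{Lan}_{abi}.$$ A homogeneous nonlinear connection $N$ on $A$ (smooth coefficients $N_i^k(x,y)$, positively $1$-homogeneous in $y$, with the usual transformation law under changes of charts of $M$) is symmetric if $N^k_{i\cdot j}=N^k_{j\cdot i}$. With $J=N-N^L$ and $$\mathcal B_i=\frac{n+2}{2}\,\frac{y_a}{L}J_i^a-C_aJ_i^a-\frac12\left(J^a_{i\cdot a}+J^a_{a\cdot i}\right),$$ $N$ is a solution of the affine equation if $$(2\,\mathrm{Lan}_a+2\mathcal B_a)(\delta_i^a y^j-y^a\delta_i^j)-(J^j_{i\cdot a}-J^j_{a\cdot i})y^a=0\quad\text{on }A,$$ and it is a proper solution if moreover $N$ extends smoothly to $\overline A$. Let $Z=Z^a\partial_a$ be a smooth $2$-homogeneous anisotropic vector field on $A$ (a section over $A$ of the pullback of $TM$ with $Z_{\lambda v}=\lambda^2Z_v$ for $\lambda>0$). Suppose that $N=N^L+\dot\partial Z$,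 i.e. $N_i^k=(N^L)_i^k+Z^k_{\cdot i}$, is a symmetric proper solution of the affine equation and that $$2\,C_{a\cdot i}Z^a+C_aZ^a_{\cdot i}+\mathrm{Lan}_i=0\quad\text{on }A.$$ Then $Z=0$ on $A$, and hence $\mathrm{Lan}_i=0$ on $A$. -/

import Mathlib

open scoped Manifold ContDiff Topology

noncomputable section

namespace AnisoFinsler

/-- The model space `ℝⁿ` of the charts. -/
abbrev Eu (n : ℕ) : Type := EuclideanSpace ℝ (Fin n)

section Coordinates

/-! ### Functions of the natural coordinates `(x, y)`

In this section `ℓ`, `f` are functions of `z = (x, y) ∈ ℝⁿ × ℝⁿ`; in the applications `ℓ` is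
the expression of `L` in the natural coordinates induced by a chart of `M`. -/

variable {n : ℕ}

/-- `∂f/∂xⁱ`. -/
def dx (i : Fin n) (f : Eu n × Eu n → ℝ) (z : Eu n × Eu n) : ℝ :=
  fderiv ℝ f z (EuclideanSpace.single i (1 : ℝ), 0)

/-- The vertical derivative `f_{·i} = ∂f/∂yⁱ`. -/
def dy (i : Fin n) (f : Eu n × Eu n → ℝ) (z : Eu n × Eu n) : ℝ :=
  fderiv ℝ f z (0, EuclideanSpace.single i (1 : ℝ))

/-- The fundamental tensor `g_{ij} = L_{·i·j} / 2`. -/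
def fund (ℓ : Eu n × Eu n → ℝ) (i j : Fin n) (z : Eu n × Eu n) : ℝ :=
  (1 / 2) * dy j (dy i ℓ) z

/-- The matrix `(g_{ij})` at a point. -/
def fundMatrix (ℓ : Eu n × Eu n → ℝ) (z : Eu n × Eu n) : Matrix (Fin n) (Fin n) ℝ :=
  Matrix.of fun i j => fund ℓ i j z

/-- The inverse matrix `g^{ij}`. -/
def fundInv (ℓ : Eu n × Eu n → ℝ) (i j : Fin n) (z : Eu n × Eu n) : ℝ :=
  (fundMatrix ℓ z)⁻¹ i j

/-- `y_i = g_{ia} y^a`. -/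
def yLow (ℓ : Eu n × Eu n → ℝ) (i : Fin n) (z : Eu n × Eu n) : ℝ :=
  ∑ a, fund ℓ i a z * z.2 a

/-- The Cartan tensor `C_{ijk} = g_{ij·k} / 2`. -/
def cartan (ℓ : Eu n × Eu n → ℝ) (i j k : Fin n) (z : Eu n × Eu n) : ℝ :=
  (1 / 2) * dy k (fund ℓ i j) z

/-- The mean Cartan tensor `C_i = g^{ab} C_{abi}`. -/
def meanCartan (ℓ : Eu n × Eu n → ℝ) (i : Fin n) (z : Eu n × Eu n) : ℝ :=
  ∑ a, ∑ b, fundInv ℓ a b z * cartan ℓ a b i z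

/-- The coefficients of the metric spray,
`(G^L)^i = (1/4) g^{ia} (2 ∂_c g_{ab} - ∂_a g_{bc}) y^b y^c`. -/
def metricSpray (ℓ : Eu n × Eu n → ℝ) (i : Fin n) (z : Eu n × Eu n) : ℝ :=
  (1 / 4) * ∑ a, ∑ b, ∑ c,
    fundInv ℓ i a z * (2 * dx c (fund ℓ a b) z - dx a (fund ℓ b c) z) * z.2 b * z.2 c

/-- The coefficients `(N^L)_i^k = ∂(G^L)^k/∂y^i` of the metric nonlinear connection. -/
def metricConn (ℓ : Eu n × Eu n → ℝ) (i k : Fin n) (z : Eu n × Eu n) : ℝ :=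
  dy i (metricSpray ℓ k) z

/-- The horizontal derivative `δ_i f = ∂_i f - (N^L)_i^a ∂f/∂y^a`. -/
def deltaL (ℓ : Eu n × Eu n → ℝ) (i : Fin n) (f : Eu n × Eu n → ℝ) (z : Eu n × Eu n) : ℝ :=
  dx i f z - ∑ a, metricConn ℓ i a z * dy a f z

/-- The Landsberg tensor `Lan_{ijk} = (1/2) ∇^L_k g_{ij}`, where `∇^L` is the covariant derivative
of the Berwald anisotropic connection, `(Γ^L)_{ij}^k = (N^L)_{i·j}^k`. -/
def landsberg (ℓ : Eu n × Eu n → ℝ) (i j k : Fin n) (z : Eu n × Eu n) : ℝ :=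
  (1 / 2) * (deltaL ℓ k (fund ℓ i j) z
    - ∑ a, dy i (metricConn ℓ k a) z * fund ℓ a j z
    - ∑ a, dy j (metricConn ℓ k a) z * fund ℓ i a z)

/-- The mean Landsberg tensor `Lan_i = g^{ab} Lan_{abi}`. -/
def meanLandsberg (ℓ : Eu n × Eu n → ℝ) (i : Fin n) (z : Eu n × Eu n) : ℝ :=
  ∑ a, ∑ b, fundInv ℓ a b z * landsberg ℓ a b i z

/-- `B^J_i = ((n+2)/2) (y_a/L) J_i^a - C_a J_i^a - (1/2) (J_{i·a}^a + J_{a·i}^a)`, where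
`J i k` stands for `J_i^k`. -/
def affineB (ℓ : Eu n × Eu n → ℝ) (J : Fin n → Fin n → Eu n × Eu n → ℝ) (i : Fin n)
    (z : Eu n × Eu n) : ℝ :=
  (((n : ℝ) + 2) / 2) * ∑ a, yLow ℓ a z / ℓ z * J i a z
    - ∑ a, meanCartan ℓ a z * J i a z
    - (1 / 2) * ∑ a, (dy a (J i a) z + dy i (J a a) z)

/-- The `(i, j)` component of the left-hand side of the affine equation,
`(2 Lan_a + 2 B^J_a) (δ_i^a y^j - y^a δ_i^j) - (J_{i·a}^j - J_{a·i}^j) y^a`. -/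
def affineLHS (ℓ : Eu n × Eu n → ℝ) (J : Fin n → Fin n → Eu n × Eu n → ℝ) (i j : Fin n)
    (z : Eu n × Eu n) : ℝ :=
  ∑ a, (2 * meanLandsberg ℓ a z + 2 * affineB ℓ J a z)
      * ((if i = a then 1 else 0) * z.2 j - z.2 a * (if i = j then 1 else 0))
    - ∑ a, (dy a (J i j) z - dy i (J a j) z) * z.2 a

/-- A symmetric matrix of signature `(+, -, …, -)`. -/
def IsLorentzian (G : Matrix (Fin n) (Fin n) ℝ) : Prop :=
  ∃ P : Matrix (Fin n) (Fin n) ℝ, IsUnit P.det ∧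
    P.transpose * G * P = Matrix.diagonal fun i : Fin n => if (i : ℕ) = 0 then 1 else -1

end Coordinates

section Manifold

variable {n : ℕ} {M : Type*} [TopologicalSpace M] [ChartedSpace (Eu n) M]

/-- The smooth charts of `M`. -/
abbrev charts (n : ℕ) (M : Type*) [TopologicalSpace M] [ChartedSpace (Eu n) M] :
    Set (OpenPartialHomeomorph M (Eu n)) :=
  IsManifold.maximalAtlas (𝓡 n) ∞ M

/-- The tangent vector whose natural coordinates with respect to the chart `e` are `z = (x, y)`,
that is, `y^a ∂_a` at the point of coordinates `x`. -/
def ofCoord (e : OpenPartialHomeomorph M (Eu n)) (z : Eu n × Eu n) : TangentBundle (𝓡 n) M :=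
  ⟨e.symm z.1, mfderiv (𝓡 n) (𝓡 n) e.symm z.1 ((NormedSpace.fromTangentSpace z.1).symm z.2)⟩

/-- The part of `S ⊆ TM` over the domain of the chart `e`, in natural coordinates. -/
def coordSet (e : OpenPartialHomeomorph M (Eu n)) (S : Set (TangentBundle (𝓡 n) M)) :
    Set (Eu n × Eu n) :=
  {z | z.1 ∈ e.target ∧ ofCoord e z ∈ S}

/-- The coordinate expression of a function on (a subset of) `TM`. -/
def inCoord (e : OpenPartialHomeomorph M (Eu n)) (L : TangentBundle (𝓡 n) M → ℝ) :
    Eu n × Eu n → ℝ :=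
  fun z => L (ofCoord e z)

/-- The component `Z^i(x, y)`, in the chart `e`, of the anisotropic vector field
`v ↦ Z_v ∈ T_{π(v)}M`. -/
def comp (e : OpenPartialHomeomorph M (Eu n))
    (Z : ∀ v : TangentBundle (𝓡 n) M, TangentSpace (𝓡 n) v.proj) (i : Fin n) :
    Eu n × Eu n → ℝ :=
  fun z => NormedSpace.fromTangentSpace (e (e.symm z.1))
    (mfderiv (𝓡 n) (𝓡 n) e (e.symm z.1) (Z (ofCoord e z))) i

variable [IsManifold (𝓡 n) ∞ M]

/-- The closure of `A` in `TM` minus the zero section. -/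
def closureNZ (A : Set (TangentBundle (𝓡 n) M)) : Set (TangentBundle (𝓡 n) M) :=
  {v | v ∈ closure A ∧ v.snd ≠ 0}

/-- The boundary of `A` in `TM` minus the zero section. -/
def bdry (A : Set (TangentBundle (𝓡 n) M)) : Set (TangentBundle (𝓡 n) M) :=
  closureNZ A \ A

/-- `A` is open and conic in `TM` minus the zero section, and projects onto `M`. -/
structure IsConicDomain (A : Set (TangentBundle (𝓡 n) M)) : Prop where
  isOpen : IsOpen A
  ne_zero : ∀ v ∈ A, v.snd ≠ 0
  smul_mem : ∀ v ∈ A, ∀ c : ℝ, 0 < c → (⟨v.proj, c • v.snd⟩ : TangentBundle (𝓡 n) M) ∈ A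
  surj : ∀ p : M, ∃ v ∈ A, v.proj = p

/-- `L` is a (conic) pseudo-Finsler metric on `A` (only its values on `A` matter). -/
structure IsPseudoFinsler (A : Set (TangentBundle (𝓡 n) M)) (L : TangentBundle (𝓡 n) M → ℝ) :
    Prop extends IsConicDomain A where
  smooth : ∀ e ∈ charts n M, ContDiffOn ℝ ∞ (inCoord e L) (coordSet e A)
  homog : ∀ v ∈ A, ∀ c : ℝ, 0 < c → L ⟨v.proj, c • v.snd⟩ = c ^ 2 * L v
  nondegenerate : ∀ e ∈ charts n M, ∀ z ∈ coordSet e A, (fundMatrix (inCoord e L) z).det ≠ 0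

/-- `L` is a proper pseudo-Finsler metric on `A`. The last field says that `L` extends smoothly
to the closure of `A` in `TM` minus the zero section, the extension being zero and having
non-degenerate fundamental tensor at the boundary points. -/
structure IsProper (A : Set (TangentBundle (𝓡 n) M)) (L : TangentBundle (𝓡 n) M → ℝ) :
    Prop extends IsPseudoFinsler A L where
  connected : ∀ p : M, IsConnected {y : TangentSpace (𝓡 n) p | (⟨p, y⟩ : TangentBundle (𝓡 n) M) ∈ A}
  pos : ∀ v ∈ A, 0 < L v
  boundary : ∀ e ∈ charts n M, ∀ z ∈ coordSet e (bdry A),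
    ∃ (U : Set (Eu n × Eu n)) (ℓ : Eu n × Eu n → ℝ), IsOpen U ∧ z ∈ U ∧ ContDiffOn ℝ ∞ ℓ U ∧
      Set.EqOn ℓ (inCoord e L) (U ∩ coordSet e A) ∧ ℓ z = 0 ∧ (fundMatrix ℓ z).det ≠ 0

/-- `L` is a (properly) Lorentz-Finsler metric on `A`. -/
structure IsLorentzFinsler (A : Set (TangentBundle (𝓡 n) M)) (L : TangentBundle (𝓡 n) M → ℝ) :
    Prop extends IsProper A L where
  lorentzian : ∀ e ∈ charts n M, ∀ z ∈ coordSet e A, IsLorentzian (fundMatrix (inCoord e L) z)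

/-- `Z` is a smooth `k`-homogeneous anisotropic vector field on `A`. -/
structure IsHomogVectorField (A : Set (TangentBundle (𝓡 n) M)) (k : ℕ)
    (Z : ∀ v : TangentBundle (𝓡 n) M, TangentSpace (𝓡 n) v.proj) : Prop where
  smooth : ∀ e ∈ charts n M, ∀ i, ContDiffOn ℝ ∞ (comp e Z i) (coordSet e A)
  homog : ∀ v ∈ A, ∀ c : ℝ, 0 < c → Z ⟨v.proj, c • v.snd⟩ = c ^ k • Z v

/-- A homogeneous nonlinear connection for `A → M`, as a collection of coefficients, one for each
smooth chart of `M`: the vector `coeff e (x, y) u` has components `N_a^k(x, y) u^a`. Under the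
change of charts `x = τ(x̄)` the cocycle is
`(∂x^c/∂x̄^k) N̄_i^k = (∂²x^c/∂x̄^i∂x̄^b) ȳ^b + (∂x^a/∂x̄^i) N_a^c`. -/
structure NonlinearConnection (A : Set (TangentBundle (𝓡 n) M)) where
  coeff : OpenPartialHomeomorph M (Eu n) → Eu n × Eu n → Eu n →L[ℝ] Eu n
  smooth : ∀ e ∈ charts n M, ContDiffOn ℝ ∞ (coeff e) (coordSet e A)
  homog : ∀ e ∈ charts n M, ∀ z ∈ coordSet e A, ∀ c : ℝ, 0 < c →
    coeff e (z.1, c • z.2) = c • coeff e z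
  cocycle : ∀ e ∈ charts n M, ∀ e' ∈ charts n M, ∀ z ∈ coordSet e' A, e'.symm z.1 ∈ e.source →
    ∀ u : Eu n, let τ : Eu n → Eu n := fun x => e (e'.symm x)
      fderiv ℝ τ z.1 (coeff e' z u) = fderiv ℝ (fderiv ℝ τ) z.1 u z.2
        + coeff e (τ z.1, fderiv ℝ τ z.1 z.2) (fderiv ℝ τ z.1 u)

/-- The coefficient `N_i^k` in the chart `e`. -/
def NonlinearConnection.coef {A : Set (TangentBundle (𝓡 n) M)} (N : NonlinearConnection A)
    (e : OpenPartialHomeomorph M (Eu n)) (i k : Fin n) : Eu n × Eu n → ℝ :=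
  fun z => N.coeff e z (EuclideanSpace.single i (1 : ℝ)) k

/-- The components `J_i^k` of `J = N - N^L` in the chart `e`. -/
def NonlinearConnection.diffMetric {A : Set (TangentBundle (𝓡 n) M)} (N : NonlinearConnection A)
    (L : TangentBundle (𝓡 n) M → ℝ) (e : OpenPartialHomeomorph M (Eu n)) (i k : Fin n) :
    Eu n × Eu n → ℝ :=
  fun z => N.coef e i k z - metricConn (inCoord e L) i k z

/-- `N` is symmetric: its torsion `Tor_{ij}^k = N_{i·j}^k - N_{j·i}^k` vanishes on `A`. -/
def NonlinearConnection.IsSymmetric {A : Set (TangentBundle (𝓡 n) M)}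
    (N : NonlinearConnection A) : Prop :=
  ∀ e ∈ charts n M, ∀ z ∈ coordSet e A, ∀ i j k,
    dy j (N.coef e i k) z - dy i (N.coef e j k) z = 0

/-- `N` extends smoothly to the closure of `A` in `TM` minus the zero section. -/
def NonlinearConnection.ExtendsSmoothly {A : Set (TangentBundle (𝓡 n) M)}
    (N : NonlinearConnection A) : Prop :=
  ∀ e ∈ charts n M, ∀ z ∈ coordSet e (bdry A),
    ∃ (U : Set (Eu n × Eu n)) (F : Eu n × Eu n → Eu n →L[ℝ] Eu n), IsOpen U ∧ z ∈ U ∧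
      ContDiffOn ℝ ∞ F U ∧ Set.EqOn F (N.coeff e) (U ∩ coordSet e A)

/-- The equality `N = N^L + ∂̇Z` on `A`, i.e. `N_i^k = (N^L)_i^k + Z^k_{·i}`. -/
def NonlinearConnection.EqMetricAdd {A : Set (TangentBundle (𝓡 n) M)}
    (N : NonlinearConnection A) (L : TangentBundle (𝓡 n) M → ℝ)
    (Z : ∀ v : TangentBundle (𝓡 n) M, TangentSpace (𝓡 n) v.proj) : Prop :=
  ∀ e ∈ charts n M, ∀ z ∈ coordSet e A, ∀ i k,
    N.coef e i k z = metricConn (inCoord e L) i k z + dy i (comp e Z k) z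

/-- The space of solutions of the affine equation on `A`. -/
def Sol (A : Set (TangentBundle (𝓡 n) M)) (L : TangentBundle (𝓡 n) M → ℝ) :
    Set (NonlinearConnection A) :=
  {N | ∀ e ∈ charts n M, ∀ z ∈ coordSet e A, ∀ i j,
    affineLHS (inCoord e L) (N.diffMetric L e) i j z = 0}

/-- The space of symmetric solutions of the affine equation on `A`. -/
def SolSym (A : Set (TangentBundle (𝓡 n) M)) (L : TangentBundle (𝓡 n) M → ℝ) :
    Set (NonlinearConnection A) :=
  {N | N ∈ Sol A L ∧ N.IsSymmetric}

/-- The space of proper solutions of the affine equation. -/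
def SolProper (A : Set (TangentBundle (𝓡 n) M)) (L : TangentBundle (𝓡 n) M → ℝ) :
    Set (NonlinearConnection A) :=
  {N | N ∈ Sol A L ∧ N.ExtendsSmoothly}

end Manifold

end AnisoFinsler

end

/-! Write `f = 2 C_a Z^a + Z^a_{·a}` (`vertDiv`). For `J = ∂̇Z` the torsion term of the affine
equation vanishes, and what remains forces `Lan_i + B_i = 0`. Eliminating `Lan_i` with the extra
hypothesis leaves the purely vertical equation `(n + 2) y_a Z^a_{·i} = 2 L f_{·i}`
(`isVerticalSol_of_affineLHS`).

Euler's theorem and one vertical derivative turn it into `(n + 2) Z_i = 2 f y_i - L f_{·i}`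
(`sum_fund_mul`). Thus `f` determines `Z`, and it is enough to show `f = 0`. A second derivative,
traced with `g^{ij}`, gives `L g^{ab} f_{·a·b} = (n - 2) f` (`mul_vertTrace`).

This equation is hyperbolic, yet a maximum principle holds for the 0-homogeneous function `f² / L`
on each fibre. At a positive maximum `c`, the function `q = f² - c L` has a negative semidefinite
Hessian that vanishes along `y`. Since `g` is negative definite transversally to `y`, the trace
`g^{ab} q_{·a·b}` is nonnegative; but the equation makes it `-2c` (`eq_zero_of_isMax`).

Properness ensures that a positive maximum is attained. As `n ≥ 3`, `f² / L = L (g^{ab} f_{·a·b})² /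
(n - 2)²`, and the trace extends smoothly across `∂A`, where `L = 0`; hence `f² / L` tends to 0
there (`tendsto_boundary`). -/

noncomputable section

namespace AnisoFinsler

/-! ### Vertical calculus and homogeneity in natural coordinates. -/

section Calculus

variable {n : ℕ} {U : Set (Eu n × Eu n)} {f g : Eu n × Eu n → ℝ} {z : Eu n × Eu n}

theorem contDiffOn_fderiv_apply (hU : IsOpen U) (hf : ContDiffOn ℝ ∞ f U) (v : Eu n × Eu n) :
    ContDiffOn ℝ ∞ (fun z => fderiv ℝ f z v) U :=
  (hf.fderiv_of_isOpen hU (m := ∞) (by simp)).clm_apply contDiffOn_const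

theorem contDiffOn_dx (hU : IsOpen U) (hf : ContDiffOn ℝ ∞ f U) (i : Fin n) :
    ContDiffOn ℝ ∞ (dx i f) U :=
  contDiffOn_fderiv_apply hU hf _

theorem contDiffOn_dy (hU : IsOpen U) (hf : ContDiffOn ℝ ∞ f U) (i : Fin n) :
    ContDiffOn ℝ ∞ (dy i f) U :=
  contDiffOn_fderiv_apply hU hf _

theorem differentiableAt_of_contDiffOn (hU : IsOpen U) (hf : ContDiffOn ℝ ∞ f U) (hz : z ∈ U) :
    DifferentiableAt ℝ f z :=
  (hf.contDiffAt (hU.mem_nhds hz)).differentiableAt (by simp)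

theorem contDiff_snd_apply (i : Fin n) : ContDiff ℝ ∞ (fun z : Eu n × Eu n => z.2 i) :=
  (EuclideanSpace.proj i : Eu n →L[ℝ] ℝ).contDiff.comp contDiff_snd

theorem dx_congr (hU : IsOpen U) (h : Set.EqOn f g U) (i : Fin n) :
    Set.EqOn (dx i f) (dx i g) U := fun z hz => by
  unfold dx
  rw [Filter.EventuallyEq.fderiv_eq (h.eventuallyEq_of_mem (hU.mem_nhds hz))]

theorem dy_congr (hU : IsOpen U) (h : Set.EqOn f g U) (i : Fin n) :
    Set.EqOn (dy i f) (dy i g) U := fun z hz => by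
  unfold dy
  rw [Filter.EventuallyEq.fderiv_eq (h.eventuallyEq_of_mem (hU.mem_nhds hz))]

theorem dy_zero (i : Fin n) (z : Eu n × Eu n) : dy i (fun _ => (0 : ℝ)) z = 0 := by
  simp [dy]

theorem dy_add (hf : DifferentiableAt ℝ f z) (hg : DifferentiableAt ℝ g z) (i : Fin n) :
    dy i (fun w => f w + g w) z = dy i f z + dy i g z := by
  unfold dy; rw [fderiv_fun_add hf hg]; rfl

theorem dy_sub (hf : DifferentiableAt ℝ f z) (hg : DifferentiableAt ℝ g z) (i : Fin n) :
    dy i (fun w => f w - g w) z = dy i f z - dy i g z := by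
  unfold dy; rw [fderiv_fun_sub hf hg]; rfl

theorem dy_mul (hf : DifferentiableAt ℝ f z) (hg : DifferentiableAt ℝ g z) (i : Fin n) :
    dy i (fun w => f w * g w) z = dy i f z * g z + f z * dy i g z := by
  unfold dy; rw [fderiv_fun_mul hf hg]; simp; ring

theorem dy_const_mul (hf : DifferentiableAt ℝ f z) (c : ℝ) (i : Fin n) :
    dy i (fun w => c * f w) z = c * dy i f z := by
  unfold dy; rw [fderiv_const_mul hf]; rfl

theorem dy_sum {ι : Type*} {s : Finset ι} {F : ι → Eu n × Eu n → ℝ}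
    (hF : ∀ a ∈ s, DifferentiableAt ℝ (F a) z) (i : Fin n) :
    dy i (fun w => ∑ a ∈ s, F a w) z = ∑ a ∈ s, dy i (F a) z := by
  unfold dy; rw [fderiv_fun_sum hF]; simp

theorem dy_comm (hU : IsOpen U) (hf : ContDiffOn ℝ ∞ f U) (hz : z ∈ U) (i j : Fin n) :
    dy i (dy j f) z = dy j (dy i f) z := by
  have hc : ContDiffAt ℝ ∞ f z := hf.contDiffAt (hU.mem_nhds hz)
  have hs : IsSymmSndFDerivAt ℝ f z := hc.isSymmSndFDerivAt (by
    simpa using WithTop.coe_le_coe.2 (le_top : (2 : ℕ∞) ≤ ⊤))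
  have hd : DifferentiableAt ℝ (fderiv ℝ f) z :=
    (hc.fderiv_right (m := ∞) (by simp)).differentiableAt (by simp)
  have key : ∀ v w : Eu n × Eu n,
      fderiv ℝ (fun x => fderiv ℝ f x v) z w = fderiv ℝ (fderiv ℝ f) z w v := fun v w => by
    rw [fderiv_clm_apply hd (differentiableAt_const v)]; simp
  unfold dy
  rw [key, key]
  exact hs _ _

/-- Positive homogeneity of degree `k` in the variables `y`. -/
def IsHomog (U : Set (Eu n × Eu n)) (k : ℤ) (f : Eu n × Eu n → ℝ) : Prop :=
  ∀ z ∈ U, ∀ c : ℝ, 0 < c → f (z.1, c • z.2) = c ^ k * f z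

/-- `U` is invariant under positive dilations in `y`. -/
def IsConic (U : Set (Eu n × Eu n)) : Prop :=
  ∀ z ∈ U, ∀ c : ℝ, 0 < c → (z.1, c • z.2) ∈ U

theorem sum_smul_single (y : Eu n) : ∑ i, y i • EuclideanSpace.single i (1 : ℝ) = y := by
  ext j; simp [Finset.sum_apply, Pi.single_apply]

theorem fderiv_vert (f : Eu n × Eu n → ℝ) (z : Eu n × Eu n) (v : Eu n) :
    fderiv ℝ f z (0, v) = ∑ i, v i * dy i f z := by
  have h : ((0 : Eu n), v) = ∑ i, v i • ((0 : Eu n), EuclideanSpace.single i (1 : ℝ)) := by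
    conv_lhs => rw [← sum_smul_single v]
    ext1
    · simp [Prod.fst_sum]
    · simp [Prod.snd_sum]
  rw [h, map_sum]
  simp only [map_smul, smul_eq_mul, dy]

theorem IsHomog.euler {k : ℤ} (h : IsHomog U k f) (hf : DifferentiableAt ℝ f z) (hz : z ∈ U) :
    ∑ i, z.2 i * dy i f z = k * f z := by
  have h1 : HasDerivAt (fun c : ℝ => (z.1, c • z.2)) ((0 : Eu n), z.2) 1 := by
    simpa using (hasDerivAt_const (1 : ℝ) z.1).prodMk ((hasDerivAt_id (1 : ℝ)).smul_const z.2)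
  have h2 : HasDerivAt (fun c : ℝ => f (z.1, c • z.2)) (fderiv ℝ f z (0, z.2)) 1 := by
    have hf' : HasFDerivAt f (fderiv ℝ f z) (z.1, (1 : ℝ) • z.2) := by simpa using hf.hasFDerivAt
    exact hf'.comp_hasDerivAt (1 : ℝ) h1
  have h3 : HasDerivAt (fun c : ℝ => f (z.1, c • z.2)) (k * f z) 1 := by
    have h4 : HasDerivAt (fun c : ℝ => c ^ k * f z) (k * f z) 1 := by
      simpa using (hasDerivAt_zpow k (1 : ℝ) (by simp)).mul_const (f z)
    refine h4.congr_of_eventuallyEq ?_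
    filter_upwards [lt_mem_nhds (zero_lt_one (α := ℝ))] with c hc using h z hz c hc
  rw [← fderiv_vert, h2.unique h3]

theorem IsHomog.dy {k : ℤ} (hU : IsOpen U) (hc : IsConic U) (h : IsHomog U k f)
    (hf : ContDiffOn ℝ ∞ f U) (i : Fin n) : IsHomog U (k - 1) (dy i f) := by
  intro z hz c hc0
  have hT : HasFDerivAt (fun w : Eu n × Eu n => (w.1, c • w.2))
      ((ContinuousLinearMap.fst ℝ (Eu n) (Eu n)).prod
        (c • ContinuousLinearMap.snd ℝ (Eu n) (Eu n))) z :=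
    ContinuousLinearMap.hasFDerivAt ((ContinuousLinearMap.fst ℝ (Eu n) (Eu n)).prod
        (c • ContinuousLinearMap.snd ℝ (Eu n) (Eu n)))
  have h1 := (differentiableAt_of_contDiffOn hU hf (hc z hz c hc0)).hasFDerivAt.comp z hT
  have h2 := (differentiableAt_of_contDiffOn hU hf hz).hasFDerivAt.const_mul (c ^ k)
  have h3 : (f ∘ fun w : Eu n × Eu n => (w.1, c • w.2)) =ᶠ[𝓝 z] fun w => c ^ k * f w := by
    filter_upwards [hU.mem_nhds hz] with w hw using h w hw c hc0
  have h4 := congrArg (fun T : Eu n × Eu n →L[ℝ] ℝ => T (0, EuclideanSpace.single i (1 : ℝ)))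
    (h1.unique (h2.congr_of_eventuallyEq h3))
  have h5 : c * AnisoFinsler.dy i f (z.1, c • z.2) = c ^ k * AnisoFinsler.dy i f z := by
    have e : ((0 : Eu n), c • EuclideanSpace.single i (1 : ℝ))
        = c • ((0 : Eu n), EuclideanSpace.single i (1 : ℝ)) := by simp
    simpa [AnisoFinsler.dy, e, -PiLp.smul_apply, -Prod.smul_mk] using h4
  rw [zpow_sub_one₀ hc0.ne', mul_assoc, mul_comm c⁻¹, ← mul_assoc, ← h5]
  field_simp

theorem IsHomog.mul {k l : ℤ} (hf : IsHomog U k f) (hg : IsHomog U l g) :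
    IsHomog U (k + l) (fun z => f z * g z) := fun z hz c hc => by
  simp only [hf z hz c hc, hg z hz c hc, zpow_add₀ hc.ne']; ring

theorem IsHomog.const_mul {k : ℤ} (hf : IsHomog U k f) (r : ℝ) :
    IsHomog U k (fun z => r * f z) := fun z hz c hc => by
  simp only [hf z hz c hc]; ring

theorem IsHomog.add {k : ℤ} (hf : IsHomog U k f) (hg : IsHomog U k g) :
    IsHomog U k (fun z => f z + g z) := fun z hz c hc => by
  simp only [hf z hz c hc, hg z hz c hc]; ring

theorem IsHomog.sum {ι : Type*} {s : Finset ι} {k : ℤ} {F : ι → Eu n × Eu n → ℝ}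
    (hF : ∀ a ∈ s, IsHomog U k (F a)) : IsHomog U k (fun z => ∑ a ∈ s, F a z) :=
  fun z hz c hc => by
    rw [Finset.mul_sum]; exact Finset.sum_congr rfl fun a ha => hF a ha z hz c hc

end Calculus

/-! ### Lorentzian linear algebra. -/

section LinearAlgebra

open Matrix

variable {n : ℕ} {G : Matrix (Fin n) (Fin n) ℝ}

/-- The columns of `P` are an orthonormal basis, and such a `u` combines only the spacelike ones. -/
theorem IsLorentzian.exists_basis (hG : IsLorentzian G) :
    ∃ P : Matrix (Fin n) (Fin n) ℝ, IsUnit P.det ∧ ∀ u : Fin n → ℝ,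
      (∀ i : Fin n, (i : ℕ) = 0 → u i = 0) → (P *ᵥ u) ⬝ᵥ G *ᵥ (P *ᵥ u) ≤ 0 := by
  obtain ⟨P, hP, hD⟩ := hG
  refine ⟨P, hP, fun u hu => ?_⟩
  have h : (P *ᵥ u) ⬝ᵥ G *ᵥ (P *ᵥ u) = u ⬝ᵥ (Pᵀ * G * P) *ᵥ u := by
    rw [← mulVec_mulVec, ← mulVec_mulVec, dotProduct_mulVec u, vecMul_transpose]
  rw [h, hD]
  simp only [dotProduct, mulVec_diagonal]
  refine Finset.sum_nonpos fun i _ => ?_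
  split_ifs with h0
  · simp [hu i h0]
  · nlinarith [mul_self_nonneg (u i)]

/-- The reverse Cauchy-Schwarz inequality. -/
theorem IsLorentzian.reverse_cauchySchwarz (hG : IsLorentzian G) (hs : G.IsSymm)
    {y : Fin n → ℝ} (hy : 0 < y ⬝ᵥ G *ᵥ y) (v : Fin n → ℝ) :
    (v ⬝ᵥ G *ᵥ v) * (y ⬝ᵥ G *ᵥ y) ≤ (y ⬝ᵥ G *ᵥ v) ^ 2 := by
  obtain ⟨P, hP, hneg⟩ := hG.exists_basis
  have hinv : ∀ w, P *ᵥ (P⁻¹ *ᵥ w) = w := fun w => by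
    rw [mulVec_mulVec, mul_nonsing_inv P hP, one_mulVec]
  have h0 : ∃ i : Fin n, (i : ℕ) = 0 ∧ (P⁻¹ *ᵥ y) i ≠ 0 := by
    by_contra! h
    have := hneg (P⁻¹ *ᵥ y) h
    rw [hinv] at this
    linarith
  obtain ⟨i, hi, hyi⟩ := h0
  -- This `t` cancels the timelike coordinate of `v - t y`, so the form is nonpositive on that
  -- vector.
  set t := (P⁻¹ *ᵥ v) i / (P⁻¹ *ᵥ y) i with ht
  have hu := hneg (P⁻¹ *ᵥ (v - t • y)) fun j hj => by
    obtain rfl : j = i := Fin.ext (hj.trans hi.symm)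
    rw [mulVec_sub, mulVec_smul, Pi.sub_apply, Pi.smul_apply, smul_eq_mul, ht,
      div_mul_cancel₀ _ hyi, sub_self]
  have hvy : v ⬝ᵥ G *ᵥ y = y ⬝ᵥ G *ᵥ v := by
    rw [dotProduct_mulVec, ← mulVec_transpose, hs.eq, dotProduct_comm]
  rw [hinv] at hu
  simp only [mulVec_sub, mulVec_smul, sub_dotProduct, dotProduct_sub, smul_dotProduct,
    dotProduct_smul, smul_eq_mul, hvy] at hu
  nlinarith [sq_nonneg (t * (y ⬝ᵥ G *ᵥ y) - y ⬝ᵥ G *ᵥ v), mul_nonpos_of_nonneg_of_nonpos hy.le hu]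

/-- With `R = Bᵀ B`, the trace is the sum of the values of the form `Q` on the rows of `B`. -/
theorem trace_mul_nonpos {R Q : Matrix (Fin n) (Fin n) ℝ} (hR : R.PosSemidef)
    (hQ : ∀ v, v ⬝ᵥ Q *ᵥ v ≤ 0) : (R * Q).trace ≤ 0 := by
  open scoped MatrixOrder in
  obtain ⟨B, rfl⟩ := CStarAlgebra.nonneg_iff_eq_star_mul_self.mp hR.nonneg
  rw [Matrix.mul_assoc, trace_mul_comm, Matrix.mul_assoc]
  refine Finset.sum_nonpos fun k _ => ?_
  refine le_of_eq_of_le ?_ (hQ (B k))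
  rw [diag_apply, mul_apply']
  congr 1

/-- Reverse Cauchy–Schwarz, applied to `G⁻¹ ξ`, says that `R = y yᵀ / G(y, y) - G⁻¹` is positive
semidefinite. The `y yᵀ` part contributes nothing because `Q(y, y) = 0`, so the trace is `-tr (R Q)
≥ 0`. -/
theorem IsLorentzian.trace_inv_mul_nonneg (hG : IsLorentzian G) (hs : G.IsSymm)
    (hdet : G.det ≠ 0) {y : Fin n → ℝ} (hy : 0 < y ⬝ᵥ G *ᵥ y)
    {Q : Matrix (Fin n) (Fin n) ℝ} (hQ : ∀ v, v ⬝ᵥ Q *ᵥ v ≤ 0) (hQy : y ⬝ᵥ Q *ᵥ y = 0) :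
    0 ≤ (G⁻¹ * Q).trace := by
  have hR : ((y ⬝ᵥ G *ᵥ y)⁻¹ • vecMulVec y y - G⁻¹).PosSemidef := by
    refine PosSemidef.of_dotProduct_mulVec_nonneg ?_ fun ξ => ?_
    · ext a b
      simp [vecMulVec_apply, mul_comm, IsSymm.apply hs.inv]
    · have h := hG.reverse_cauchySchwarz hs hy (G⁻¹ *ᵥ ξ)
      rw [mulVec_mulVec, mul_nonsing_inv G hdet.isUnit, one_mulVec] at h
      rw [star_trivial, sub_mulVec, smul_mulVec, vecMulVec_mulVec, dotProduct_sub,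
        dotProduct_smul, dotProduct_comm ξ (G⁻¹ *ᵥ ξ), sub_nonneg, smul_eq_mul,
        le_inv_mul_iff₀' hy]
      refine h.trans (le_of_eq ?_)
      simp [dotProduct_comm ξ y, sq]
  have := trace_mul_nonpos hR hQ
  rw [Matrix.sub_mul, trace_sub, Matrix.smul_mul, trace_smul, vecMulVec_mul, trace_vecMulVec,
    dotProduct_comm y (y ᵥ* Q), ← dotProduct_mulVec, hQy] at this
  simpa using this

end LinearAlgebra

/-! ### Tensors of a pseudo-Finsler metric: smoothness, locality, Euler identities. -/

section Finsler

variable {n : ℕ} {U : Set (Eu n × Eu n)} {ℓ ℓ' : Eu n × Eu n → ℝ} {z : Eu n × Eu n}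
  {Z Z' : Fin n → Eu n × Eu n → ℝ}

/-- `2 C_a Z^a + Z^a_{·a}`, the divergence of `Z` with respect to `|det g|`. -/
def vertDiv (ℓ : Eu n × Eu n → ℝ) (Z : Fin n → Eu n × Eu n → ℝ) (z : Eu n × Eu n) : ℝ :=
  2 * ∑ a, meanCartan ℓ a z * Z a z + ∑ a, dy a (Z a) z

/-- `g^{ab} f_{·a·b}`. -/
def vertTrace (ℓ f : Eu n × Eu n → ℝ) (z : Eu n × Eu n) : ℝ :=
  ∑ a, ∑ b, fundInv ℓ a b z * dy b (dy a f) z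

/-! ### Smoothness -/

theorem contDiffOn_fund (hU : IsOpen U) (hℓ : ContDiffOn ℝ ∞ ℓ U) (i j : Fin n) :
    ContDiffOn ℝ ∞ (fund ℓ i j) U :=
  contDiffOn_const.mul (contDiffOn_dy hU (contDiffOn_dy hU hℓ i) j)

theorem contDiffOn_det {F : Eu n × Eu n → Matrix (Fin n) (Fin n) ℝ}
    (hF : ∀ i j, ContDiffOn ℝ ∞ (fun z => F z i j) U) : ContDiffOn ℝ ∞ (fun z => (F z).det) U := by
  simp only [Matrix.det_apply, Units.smul_def, zsmul_eq_mul]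
  exact ContDiffOn.sum fun σ _ => contDiffOn_const.mul (contDiffOn_prod fun i _ => hF _ _)

theorem contDiffOn_det_fundMatrix (hU : IsOpen U) (hℓ : ContDiffOn ℝ ∞ ℓ U) :
    ContDiffOn ℝ ∞ (fun z => (fundMatrix ℓ z).det) U :=
  contDiffOn_det fun i j => contDiffOn_fund hU hℓ i j

theorem contDiffOn_fundInv (hU : IsOpen U) (hℓ : ContDiffOn ℝ ∞ ℓ U)
    (hd : ∀ z ∈ U, (fundMatrix ℓ z).det ≠ 0) (i j : Fin n) : ContDiffOn ℝ ∞ (fundInv ℓ i j) U := by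
  -- Cramer's rule exhibits the entries as rational functions of the `g_{ij}`.
  have h : fundInv ℓ i j = fun z => (fundMatrix ℓ z).det⁻¹ *
      ((fundMatrix ℓ z).updateRow j (Pi.single i 1)).det := by
    funext z
    rw [fundInv, Matrix.inv_def, Matrix.smul_apply, Ring.inverse_eq_inv', smul_eq_mul,
      Matrix.adjugate_apply]
  rw [h]
  refine ((contDiffOn_det_fundMatrix hU hℓ).inv hd).mul (contDiffOn_det fun a b => ?_)
  simp only [Matrix.updateRow_apply]
  split_ifs
  · exact contDiffOn_const
  · exact contDiffOn_fund hU hℓ a b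

theorem contDiffOn_cartan (hU : IsOpen U) (hℓ : ContDiffOn ℝ ∞ ℓ U) (i j k : Fin n) :
    ContDiffOn ℝ ∞ (cartan ℓ i j k) U :=
  contDiffOn_const.mul (contDiffOn_dy hU (contDiffOn_fund hU hℓ i j) k)

theorem contDiffOn_meanCartan (hU : IsOpen U) (hℓ : ContDiffOn ℝ ∞ ℓ U)
    (hd : ∀ z ∈ U, (fundMatrix ℓ z).det ≠ 0) (i : Fin n) : ContDiffOn ℝ ∞ (meanCartan ℓ i) U :=
  ContDiffOn.sum fun a _ => ContDiffOn.sum fun b _ =>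
    (contDiffOn_fundInv hU hℓ hd a b).mul (contDiffOn_cartan hU hℓ a b i)

theorem contDiffOn_metricSpray (hU : IsOpen U) (hℓ : ContDiffOn ℝ ∞ ℓ U)
    (hd : ∀ z ∈ U, (fundMatrix ℓ z).det ≠ 0) (i : Fin n) : ContDiffOn ℝ ∞ (metricSpray ℓ i) U :=
  contDiffOn_const.mul <| ContDiffOn.sum fun a _ => ContDiffOn.sum fun b _ => ContDiffOn.sum
    fun c _ => (((contDiffOn_fundInv hU hℓ hd i a).mul ((contDiffOn_const.mul
      (contDiffOn_dx hU (contDiffOn_fund hU hℓ a b) c)).sub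
        (contDiffOn_dx hU (contDiffOn_fund hU hℓ b c) a))).mul
          (contDiff_snd_apply b).contDiffOn).mul (contDiff_snd_apply c).contDiffOn

theorem contDiffOn_metricConn (hU : IsOpen U) (hℓ : ContDiffOn ℝ ∞ ℓ U)
    (hd : ∀ z ∈ U, (fundMatrix ℓ z).det ≠ 0) (i k : Fin n) :
    ContDiffOn ℝ ∞ (metricConn ℓ i k) U :=
  contDiffOn_dy hU (contDiffOn_metricSpray hU hℓ hd k) i

theorem contDiffOn_vertDiv (hU : IsOpen U) (hℓ : ContDiffOn ℝ ∞ ℓ U)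
    (hd : ∀ z ∈ U, (fundMatrix ℓ z).det ≠ 0) (hZ : ∀ a, ContDiffOn ℝ ∞ (Z a) U) :
    ContDiffOn ℝ ∞ (vertDiv ℓ Z) U :=
  (contDiffOn_const.mul (ContDiffOn.sum fun a _ =>
    (contDiffOn_meanCartan hU hℓ hd a).mul (hZ a))).add
      (ContDiffOn.sum fun a _ => contDiffOn_dy hU (hZ a) a)

theorem contDiffOn_vertTrace {f : Eu n × Eu n → ℝ} (hU : IsOpen U) (hℓ : ContDiffOn ℝ ∞ ℓ U)
    (hd : ∀ z ∈ U, (fundMatrix ℓ z).det ≠ 0) (hf : ContDiffOn ℝ ∞ f U) :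
    ContDiffOn ℝ ∞ (vertTrace ℓ f) U :=
  ContDiffOn.sum fun a _ => ContDiffOn.sum fun b _ =>
    (contDiffOn_fundInv hU hℓ hd a b).mul (contDiffOn_dy hU (contDiffOn_dy hU hf a) b)

/-! ### Locality -/

/-- This and its analogues below compare the tensors of an extension of `L` across `∂A` with those
of `L`, on the open set where the two functions agree. -/
theorem fund_congr (hU : IsOpen U) (h : Set.EqOn ℓ ℓ' U) (i j : Fin n) :
    Set.EqOn (fund ℓ i j) (fund ℓ' i j) U := fun z hz => by
  rw [fund, fund, dy_congr hU (dy_congr hU h i) j hz]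

theorem fundMatrix_congr (hU : IsOpen U) (h : Set.EqOn ℓ ℓ' U) :
    Set.EqOn (fundMatrix ℓ) (fundMatrix ℓ') U := fun z hz => by
  ext i j; exact fund_congr hU h i j hz

theorem fundInv_congr (hU : IsOpen U) (h : Set.EqOn ℓ ℓ' U) (i j : Fin n) :
    Set.EqOn (fundInv ℓ i j) (fundInv ℓ' i j) U := fun z hz => by
  rw [fundInv, fundInv, fundMatrix_congr hU h hz]

theorem cartan_congr (hU : IsOpen U) (h : Set.EqOn ℓ ℓ' U) (i j k : Fin n) :
    Set.EqOn (cartan ℓ i j k) (cartan ℓ' i j k) U := fun z hz => by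
  rw [cartan, cartan, dy_congr hU (fund_congr hU h i j) k hz]

theorem meanCartan_congr (hU : IsOpen U) (h : Set.EqOn ℓ ℓ' U) (i : Fin n) :
    Set.EqOn (meanCartan ℓ i) (meanCartan ℓ' i) U := fun z hz =>
  Finset.sum_congr rfl fun a _ => Finset.sum_congr rfl fun b _ => by
    rw [fundInv_congr hU h a b hz, cartan_congr hU h a b i hz]

theorem metricSpray_congr (hU : IsOpen U) (h : Set.EqOn ℓ ℓ' U) (i : Fin n) :
    Set.EqOn (metricSpray ℓ i) (metricSpray ℓ' i) U := fun z hz => by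
  unfold metricSpray
  refine congrArg _ (Finset.sum_congr rfl fun a _ => Finset.sum_congr rfl fun b _ =>
    Finset.sum_congr rfl fun c _ => ?_)
  rw [fundInv_congr hU h i a hz, dx_congr hU (fund_congr hU h a b) c hz,
    dx_congr hU (fund_congr hU h b c) a hz]

theorem metricConn_congr (hU : IsOpen U) (h : Set.EqOn ℓ ℓ' U) (i k : Fin n) :
    Set.EqOn (metricConn ℓ i k) (metricConn ℓ' i k) U :=
  dy_congr hU (metricSpray_congr hU h k) i

theorem vertDiv_congr (hU : IsOpen U) (h : Set.EqOn ℓ ℓ' U) (hZ : ∀ a, Set.EqOn (Z a) (Z' a) U) :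
    Set.EqOn (vertDiv ℓ Z) (vertDiv ℓ' Z') U := fun z hz => by
  unfold vertDiv
  congr 1
  · exact congrArg _ (Finset.sum_congr rfl fun a _ => by
      rw [meanCartan_congr hU h a hz, hZ a hz])
  · exact Finset.sum_congr rfl fun a _ => dy_congr hU (hZ a) a hz

theorem vertTrace_congr {f f' : Eu n × Eu n → ℝ} (hU : IsOpen U) (h : Set.EqOn ℓ ℓ' U)
    (hf : Set.EqOn f f' U) : Set.EqOn (vertTrace ℓ f) (vertTrace ℓ' f') U := fun z hz =>
  Finset.sum_congr rfl fun a _ => Finset.sum_congr rfl fun b _ => by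
    rw [fundInv_congr hU h a b hz, dy_congr hU (dy_congr hU hf a) b hz]

/-! ### Homogeneity and Euler's identities -/

/-- `ℓ` is the expression in natural coordinates of a pseudo-Finsler metric defined on `U`. -/
structure IsFinslerOn (U : Set (Eu n × Eu n)) (ℓ : Eu n × Eu n → ℝ) : Prop where
  isOpen : IsOpen U
  conic : IsConic U
  smooth : ContDiffOn ℝ ∞ ℓ U
  homog : IsHomog U 2 ℓ
  det_ne : ∀ z ∈ U, (fundMatrix ℓ z).det ≠ 0

namespace IsFinslerOn

theorem homog_fund (h : IsFinslerOn U ℓ) (i j : Fin n) : IsHomog U 0 (fund ℓ i j) :=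
  (((h.homog.dy h.isOpen h.conic h.smooth i).dy h.isOpen h.conic
    (contDiffOn_dy h.isOpen h.smooth i) j)).const_mul _

theorem homog_fundInv (h : IsFinslerOn U ℓ) (i j : Fin n) : IsHomog U 0 (fundInv ℓ i j) :=
  fun z hz c hc => by
    have : fundMatrix ℓ (z.1, c • z.2) = fundMatrix ℓ z := by
      ext a b; simpa [fundMatrix] using h.homog_fund a b z hz c hc
    simp [fundInv, this]

theorem homog_meanCartan (h : IsFinslerOn U ℓ) (i : Fin n) : IsHomog U (-1) (meanCartan ℓ i) :=
  IsHomog.sum fun a _ => IsHomog.sum fun b _ => (h.homog_fundInv a b).mul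
    (((h.homog_fund a b).dy h.isOpen h.conic (contDiffOn_fund h.isOpen h.smooth a b) i).const_mul _)

theorem homog_vertDiv (h : IsFinslerOn U ℓ) (hZ : ∀ a, ContDiffOn ℝ ∞ (Z a) U)
    (hZh : ∀ a, IsHomog U 2 (Z a)) : IsHomog U 1 (vertDiv ℓ Z) :=
  ((IsHomog.sum fun a _ => (h.homog_meanCartan a).mul (hZh a)).const_mul 2).add
    (IsHomog.sum fun a _ => (hZh a).dy h.isOpen h.conic (hZ a) a)

theorem contDiffOn_vertDiv (h : IsFinslerOn U ℓ) (hZ : ∀ a, ContDiffOn ℝ ∞ (Z a) U) :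
    ContDiffOn ℝ ∞ (vertDiv ℓ Z) U :=
  AnisoFinsler.contDiffOn_vertDiv h.isOpen h.smooth h.det_ne hZ

theorem fund_comm (h : IsFinslerOn U ℓ) (hz : z ∈ U) (i j : Fin n) :
    fund ℓ i j z = fund ℓ j i z := by
  rw [fund, fund, dy_comm h.isOpen h.smooth hz]

theorem isSymm_fundMatrix (h : IsFinslerOn U ℓ) (hz : z ∈ U) : (fundMatrix ℓ z).IsSymm := by
  ext i j; exact h.fund_comm hz j i

/-- Euler's identity for `ℓ_{·i}`, which has degree 1. With `y_i` reduced to a single derivative,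
`y_{i·j} = g_{ij}` is immediate. -/
theorem yLow_eq (h : IsFinslerOn U ℓ) (i : Fin n) :
    Set.EqOn (yLow ℓ i) (fun z => 1 / 2 * dy i ℓ z) U := fun z hz => by
  have := (h.homog.dy h.isOpen h.conic h.smooth i).euler
    (differentiableAt_of_contDiffOn h.isOpen (contDiffOn_dy h.isOpen h.smooth i) hz) hz
  simp only [yLow, fund]
  norm_num at this
  rw [← this, Finset.mul_sum]
  exact Finset.sum_congr rfl fun a _ => by ring

theorem contDiffOn_yLow (h : IsFinslerOn U ℓ) (i : Fin n) : ContDiffOn ℝ ∞ (yLow ℓ i) U :=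
  (contDiffOn_const.mul (contDiffOn_dy h.isOpen h.smooth i)).congr (h.yLow_eq i)

theorem dy_yLow (h : IsFinslerOn U ℓ) (hz : z ∈ U) (i j : Fin n) :
    dy j (yLow ℓ i) z = fund ℓ i j z := by
  rw [dy_congr h.isOpen (h.yLow_eq i) j hz, dy_const_mul (differentiableAt_of_contDiffOn h.isOpen
    (contDiffOn_dy h.isOpen h.smooth i) hz), fund]

theorem sum_snd_mul_yLow (h : IsFinslerOn U ℓ) (hz : z ∈ U) : ∑ i, z.2 i * yLow ℓ i z = ℓ z := by
  have := h.homog.euler (differentiableAt_of_contDiffOn h.isOpen h.smooth hz) hz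
  have e : ∀ i, z.2 i * yLow ℓ i z = 1 / 2 * (z.2 i * dy i ℓ z) := fun i => by
    rw [h.yLow_eq i hz]; ring
  rw [Finset.sum_congr rfl fun i _ => e i, ← Finset.mul_sum, this]
  push_cast
  ring

theorem cartan_comm (h : IsFinslerOn U ℓ) (hz : z ∈ U) (i j k : Fin n) :
    cartan ℓ i j k z = cartan ℓ i k j z := by
  have hs := contDiffOn_dy h.isOpen h.smooth i
  have e : ∀ a b, dy b (fund ℓ i a) z = 1 / 2 * dy b (dy a (dy i ℓ)) z := fun a b =>
    dy_const_mul (differentiableAt_of_contDiffOn h.isOpen (contDiffOn_dy h.isOpen hs a) hz) _ _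
  rw [cartan, cartan, e, e, dy_comm h.isOpen hs hz]

theorem sum_fundInv_mul_fund (h : IsFinslerOn U ℓ) (hz : z ∈ U) (a b : Fin n) :
    ∑ i, fundInv ℓ a i z * fund ℓ i b z = if a = b then 1 else 0 := by
  have := congrFun (congrFun (Matrix.nonsing_inv_mul (fundMatrix ℓ z) (h.det_ne z hz).isUnit) a) b
  rwa [Matrix.mul_apply, Matrix.one_apply] at this

theorem fundInv_comm (h : IsFinslerOn U ℓ) (hz : z ∈ U) (i j : Fin n) :
    fundInv ℓ i j z = fundInv ℓ j i z :=
  (h.isSymm_fundMatrix hz).inv.apply j i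

end IsFinslerOn

end Finsler

/-! ### From the vertical equation to a scalar equation for its divergence. -/

section VerticalEquation

variable {n : ℕ} {U : Set (Eu n × Eu n)} {ℓ : Eu n × Eu n → ℝ} {z : Eu n × Eu n}
  {Z : Fin n → Eu n × Eu n → ℝ}

/-- `Z` is a smooth `2`-homogeneous solution on `U` of the vertical equation
`(n + 2) y_a Z^a_{·i} = 2 ℓ (2 C_a Z^a + Z^a_{·a})_{·i}`. -/
structure IsVerticalSol (U : Set (Eu n × Eu n)) (ℓ : Eu n × Eu n → ℝ)
    (Z : Fin n → Eu n × Eu n → ℝ) : Prop where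
  smooth : ∀ a, ContDiffOn ℝ ∞ (Z a) U
  homog : ∀ a, IsHomog U 2 (Z a)
  eq : ∀ z ∈ U, ∀ i,
    ((n : ℝ) + 2) * ∑ a, yLow ℓ a z * dy i (Z a) z = 2 * ℓ z * dy i (vertDiv ℓ Z) z

namespace IsVerticalSol

/-- Contract the vertical equation with `y^i` and apply Euler: `Z^a` has degree 2 and `f` degree 1.
-/
theorem sum_yLow_mul (hZ : IsVerticalSol U ℓ Z) (h : IsFinslerOn U ℓ) :
    Set.EqOn (fun z => ((n : ℝ) + 2) * ∑ a, yLow ℓ a z * Z a z)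
      (fun z => ℓ z * vertDiv ℓ Z z) U := fun z hz => by
  have h1 : ∀ a, ∑ i, z.2 i * dy i (Z a) z = 2 * Z a z := fun a => by
    simpa using (hZ.homog a).euler (differentiableAt_of_contDiffOn h.isOpen (hZ.smooth a) hz) hz
  have h2 : ∑ i, z.2 i * dy i (vertDiv ℓ Z) z = vertDiv ℓ Z z := by
    simpa using (h.homog_vertDiv hZ.smooth hZ.homog).euler
      (differentiableAt_of_contDiffOn h.isOpen (h.contDiffOn_vertDiv hZ.smooth) hz) hz
  have h3 : ∑ i, z.2 i * (((n : ℝ) + 2) * ∑ a, yLow ℓ a z * dy i (Z a) z)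
      = ((n : ℝ) + 2) * ∑ a, yLow ℓ a z * (2 * Z a z) := by
    simp only [← h1, Finset.mul_sum]
    rw [Finset.sum_comm]
    exact Finset.sum_congr rfl fun a _ => Finset.sum_congr rfl fun i _ => by ring
  have h4 : ∑ i, z.2 i * (2 * ℓ z * dy i (vertDiv ℓ Z) z) = 2 * ℓ z * vertDiv ℓ Z z := by
    conv_rhs => rw [← h2, Finset.mul_sum]
    exact Finset.sum_congr rfl fun i _ => by ring
  simp only [hZ.eq z hz, h4] at h3
  have h5 : ∑ a, yLow ℓ a z * (2 * Z a z) = 2 * ∑ a, yLow ℓ a z * Z a z := by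
    rw [Finset.mul_sum]; exact Finset.sum_congr rfl fun a _ => by ring
  simp only [h5] at h3 ⊢
  linarith

/-- `(n + 2) Z_i = 2 f y_i - ℓ f_{·i}`, where `f = 2 C_a Z^a + Z^a_{·a}`. -/
theorem sum_fund_mul (hZ : IsVerticalSol U ℓ Z) (h : IsFinslerOn U ℓ) (i : Fin n) :
    Set.EqOn (fun z => ((n : ℝ) + 2) * ∑ a, fund ℓ i a z * Z a z)
      (fun z => 2 * (vertDiv ℓ Z z * yLow ℓ i z) - ℓ z * dy i (vertDiv ℓ Z) z) U := fun z hz => by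
  have dZ := fun a => differentiableAt_of_contDiffOn h.isOpen (hZ.smooth a) hz
  have dy' := fun a => differentiableAt_of_contDiffOn h.isOpen (h.contDiffOn_yLow a) hz
  have dℓ := differentiableAt_of_contDiffOn h.isOpen h.smooth hz
  have df := differentiableAt_of_contDiffOn h.isOpen (h.contDiffOn_vertDiv hZ.smooth) hz
  -- Differentiate `(n + 2) y_a Z^a = ℓ f`; subtracting the vertical equation then removes the terms
  -- `y_a Z^a_{·i}`.
  have h1 := dy_congr h.isOpen (hZ.sum_yLow_mul h) i hz
  rw [dy_const_mul (DifferentiableAt.fun_sum fun a _ => (dy' a).fun_mul (dZ a)),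
    dy_sum fun a _ => (dy' a).fun_mul (dZ a), dy_mul dℓ df] at h1
  have h2 : ∑ a, dy i (fun z => yLow ℓ a z * Z a z) z
      = ∑ a, fund ℓ i a z * Z a z + ∑ a, yLow ℓ a z * dy i (Z a) z := by
    rw [← Finset.sum_add_distrib]
    exact Finset.sum_congr rfl fun a _ => by
      rw [dy_mul (dy' a) (dZ a), h.dy_yLow hz, h.fund_comm hz]
  have h3 := hZ.eq z hz i
  have h4 : dy i ℓ z = 2 * yLow ℓ i z := by rw [h.yLow_eq i hz]; ring
  rw [h2, h4] at h1
  simp only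
  linarith

/-- `f = 2 C_a Z^a + Z^a_{·a}` satisfies `ℓ g^{ab} f_{·a·b} = (n - 2) f`. -/
theorem mul_vertTrace (hZ : IsVerticalSol U ℓ Z) (h : IsFinslerOn U ℓ) (hz : z ∈ U) :
    ℓ z * vertTrace ℓ (vertDiv ℓ Z) z = ((n : ℝ) - 2) * vertDiv ℓ Z z := by
  set f := vertDiv ℓ Z with hf
  have dZ := fun a => differentiableAt_of_contDiffOn h.isOpen (hZ.smooth a) hz
  have dy' := fun a => differentiableAt_of_contDiffOn h.isOpen (h.contDiffOn_yLow a) hz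
  have dℓ := differentiableAt_of_contDiffOn h.isOpen h.smooth hz
  have sf := h.contDiffOn_vertDiv hZ.smooth
  have df := differentiableAt_of_contDiffOn h.isOpen sf hz
  have ddf := fun i => differentiableAt_of_contDiffOn h.isOpen (contDiffOn_dy h.isOpen sf i) hz
  have dg := fun i a =>
    differentiableAt_of_contDiffOn h.isOpen (contDiffOn_fund h.isOpen h.smooth i a) hz
  -- The derivative in `y^j` of `(n + 2) Z_i = 2 f y_i - ℓ f_{·i}`, with `g_{ia·j} = 2 C_{ija}` by
  -- symmetry of the Cartan tensor.
  have key : ∀ i j, ((n : ℝ) + 2) * (2 * ∑ a, cartan ℓ i j a z * Z a z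
      + ∑ a, fund ℓ i a z * dy j (Z a) z)
      = 2 * (dy j f z * yLow ℓ i z) + 2 * (f z * fund ℓ i j z) - 2 * (yLow ℓ j z * dy i f z)
        - ℓ z * dy j (dy i f) z := fun i j => by
    have h1 := dy_congr h.isOpen (hZ.sum_fund_mul h i) j hz
    rw [dy_const_mul (DifferentiableAt.fun_sum fun a _ => (dg i a).fun_mul (dZ a)),
      dy_sum fun a _ => (dg i a).fun_mul (dZ a),
      dy_sub ((df.fun_mul (dy' i)).const_mul 2) (dℓ.fun_mul (ddf i)),
      dy_const_mul (df.fun_mul (dy' i)), dy_mul df (dy' i), dy_mul dℓ (ddf i), h.dy_yLow hz] at h1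
    have h2 : ∑ a, dy j (fun z => fund ℓ i a z * Z a z) z
        = 2 * ∑ a, cartan ℓ i j a z * Z a z + ∑ a, fund ℓ i a z * dy j (Z a) z := by
      rw [Finset.mul_sum, ← Finset.sum_add_distrib]
      exact Finset.sum_congr rfl fun a _ => by
        rw [dy_mul (dg i a) (dZ a), h.cartan_comm hz i j a, cartan]; ring
    have h4 : dy j ℓ z = 2 * yLow ℓ j z := by rw [h.yLow_eq j hz]; ring
    rw [h2, h4] at h1
    linarith
  have e1 : ∑ i, ∑ j, fundInv ℓ i j z * ∑ a, cartan ℓ i j a z * Z a z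
      = ∑ a, meanCartan ℓ a z * Z a z := by
    simp only [meanCartan, Finset.mul_sum, Finset.sum_mul]
    rw [Finset.sum_comm_cycle]
    exact Finset.sum_congr rfl fun a _ => Finset.sum_congr rfl fun i _ =>
      Finset.sum_congr rfl fun j _ => by ring
  have e2 : ∑ i, ∑ j, fundInv ℓ i j z * ∑ a, fund ℓ i a z * dy j (Z a) z
      = ∑ a, dy a (Z a) z := by
    have : ∀ j, ∑ i, fundInv ℓ i j z * ∑ a, fund ℓ i a z * dy j (Z a) z = dy j (Z j) z := fun j => by
      simp only [Finset.mul_sum]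
      rw [Finset.sum_comm]
      have : ∀ a, ∑ i, fundInv ℓ i j z * (fund ℓ i a z * dy j (Z a) z)
          = if j = a then dy j (Z a) z else 0 := fun a => by
        rw [show (if j = a then dy j (Z a) z else 0)
          = (if j = a then 1 else 0) * dy j (Z a) z by split_ifs <;> simp, ← h.sum_fundInv_mul_fund hz, Finset.sum_mul]
        exact Finset.sum_congr rfl fun i _ => by rw [h.fundInv_comm hz]; ring
      simp [this]
    rw [Finset.sum_comm]
    exact Finset.sum_congr rfl fun j _ => this j
  -- The two mixed terms have equal traces and enter `key` with opposite signs, so they cancel.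
  have e3 : ∑ i, ∑ j, fundInv ℓ i j z * (dy j f z * yLow ℓ i z)
      = ∑ i, ∑ j, fundInv ℓ i j z * (yLow ℓ j z * dy i f z) := by
    rw [Finset.sum_comm]
    exact Finset.sum_congr rfl fun i _ => Finset.sum_congr rfl fun j _ => by
      rw [h.fundInv_comm hz]; ring
  have e4 : ∑ i, ∑ j, fundInv ℓ i j z * (f z * fund ℓ i j z) = n * f z := by
    have : ∀ i, ∑ j, fundInv ℓ i j z * (f z * fund ℓ i j z) = f z := fun i => by
      have h1 := h.sum_fundInv_mul_fund hz i i
      rw [if_pos rfl] at h1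
      refine Eq.trans ?_ ((congrArg (f z * ·) h1).trans (mul_one _))
      simp only [Finset.mul_sum]
      exact Finset.sum_congr rfl fun j _ => by rw [h.fund_comm hz i j]; ring
    simp [this]
  have e5 : ∑ i, ∑ j, fundInv ℓ i j z * (ℓ z * dy j (dy i f) z) = ℓ z * vertTrace ℓ f z := by
    simp only [vertTrace, Finset.mul_sum]
    exact Finset.sum_congr rfl fun i _ => Finset.sum_congr rfl fun j _ => by ring
  -- Contraction with `g^{ij}`, packaged as a linear map so that `key` is traced term by term. The
  -- result is `(n + 2) f = 2 n f - ℓ g^{ab} f_{·a·b}`.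
  let T : (Fin n → Fin n → ℝ) →ₗ[ℝ] ℝ :=
    { toFun := fun u => ∑ i, ∑ j, fundInv ℓ i j z * u i j
      map_add' := fun u v => by simp [mul_add, Finset.sum_add_distrib]
      map_smul' := fun r u => by simp [Finset.mul_sum, mul_left_comm] }
  have hT := congrArg T (funext₂ key :
    ((n : ℝ) + 2) • ((2 : ℝ) • (fun i j => ∑ a, cartan ℓ i j a z * Z a z)
      + fun i j => ∑ a, fund ℓ i a z * dy j (Z a) z)
    = (2 : ℝ) • (fun i j => dy j f z * yLow ℓ i z) + (2 : ℝ) • (fun i j => f z * fund ℓ i j z)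
      - (2 : ℝ) • (fun i j => yLow ℓ j z * dy i f z) - fun i j => ℓ z * dy j (dy i f) z)
  simp only [map_add, map_sub, map_smul, smul_eq_mul] at hT
  simp only [T, LinearMap.coe_mk, AddHom.coe_mk, e1, e2, e3, e4, e5] at hT
  have hf' : 2 * ∑ a, meanCartan ℓ a z * Z a z + ∑ a, dy a (Z a) z = f z := rfl
  rw [hf'] at hT
  linarith

end IsVerticalSol

end VerticalEquation

/-! ### The maximum principle on a fibre. -/

section MaximumPrinciple

open Matrix

variable {n : ℕ} {U : Set (Eu n × Eu n)} {ℓ f : Eu n × Eu n → ℝ} {z : Eu n × Eu n}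

/-- If the second derivative were positive, `t` would also be a local minimum, so `φ` would be
locally constant. -/
theorem deriv_deriv_nonpos_of_isLocalMax {φ : ℝ → ℝ} {t : ℝ} (h : IsLocalMax φ t)
    (hc : ContinuousAt φ t) : deriv (deriv φ) t ≤ 0 := by
  by_contra! hpos
  have hmin := isLocalMin_of_deriv_deriv_pos hpos h.deriv_eq_zero hc
  have heq : φ =ᶠ[𝓝 t] fun _ => φ t := by
    filter_upwards [h, hmin] with s h1 h2 using le_antisymm h1 h2
  have := heq.deriv.deriv_eq
  simp [this] at hpos

theorem hasDerivAt_vertLine {t : ℝ} {v : Eu n}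
    (hf : DifferentiableAt ℝ f (z.1, z.2 + t • v)) :
    HasDerivAt (fun s : ℝ => f (z.1, z.2 + s • v))
      (∑ i, v i * dy i f (z.1, z.2 + t • v)) t := by
  have h1 : HasDerivAt (fun s : ℝ => (z.1, z.2 + s • v)) ((0 : Eu n), v) t := by
    simpa using (hasDerivAt_const t z.1).prodMk (((hasDerivAt_id t).smul_const v).const_add z.2)
  rw [← fderiv_vert]
  exact hf.hasFDerivAt.comp_hasDerivAt t h1

/-- The first and second order conditions at a vertical maximum. -/
theorem dy_eq_zero_and_hessian_nonpos {q : Eu n × Eu n → ℝ} (hU : IsOpen U)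
    (hq : ContDiffOn ℝ ∞ q U) (hz : z ∈ U) (hmax : ∀ y, (z.1, y) ∈ U → q (z.1, y) ≤ q z) :
    (∀ i, dy i q z = 0) ∧ ∀ v : Eu n, ∑ i, v i * ∑ j, v j * dy j (dy i q) z ≤ 0 := by
  have hmem : ∀ v : Eu n, ∀ᶠ t : ℝ in 𝓝 0, (z.1, z.2 + t • v) ∈ U := fun v => by
    have : ContinuousAt (fun t : ℝ => (z.1, z.2 + t • v)) 0 := by fun_prop
    refine this.eventually_mem (hU.mem_nhds ?_)
    simpa using hz
  have hloc : ∀ v : Eu n, IsLocalMax (fun t : ℝ => q (z.1, z.2 + t • v)) 0 := fun v => by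
    filter_upwards [hmem v] with t ht
    simpa using hmax _ ht
  have hd : ∀ v : Eu n, ∀ᶠ t : ℝ in 𝓝 0, HasDerivAt (fun s : ℝ => q (z.1, z.2 + s • v))
      (∑ i, v i * dy i q (z.1, z.2 + t • v)) t := fun v => by
    filter_upwards [hmem v] with t ht
    exact hasDerivAt_vertLine (differentiableAt_of_contDiffOn hU hq ht)
  constructor
  · intro i
    have := (hloc (EuclideanSpace.single i 1)).hasDerivAt_eq_zero
      (hd (EuclideanSpace.single i 1)).self_of_nhds
    simpa [Pi.single_apply] using this
  · intro v
    have h1 : deriv (fun s : ℝ => q (z.1, z.2 + s • v)) =ᶠ[𝓝 0]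
        fun t => ∑ i, v i * dy i q (z.1, z.2 + t • v) := by
      filter_upwards [hd v] with t ht using ht.deriv
    have hz' : (z.1, z.2 + (0 : ℝ) • v) ∈ U := by simpa using hz
    have h2 : HasDerivAt (fun t : ℝ => ∑ i, v i * dy i q (z.1, z.2 + t • v))
        (∑ i, v i * ∑ j, v j * dy j (dy i q) z) 0 := by
      refine HasDerivAt.fun_sum fun i _ => HasDerivAt.const_mul (v i) ?_
      simpa using hasDerivAt_vertLine
        (differentiableAt_of_contDiffOn hU (contDiffOn_dy hU hq i) hz')
    have := deriv_deriv_nonpos_of_isLocalMax (hloc v) (hd v).self_of_nhds.continuousAt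
    rwa [h1.deriv_eq, h2.deriv] at this

theorem IsFinslerOn.sum_fundInv_mul_yLow (h : IsFinslerOn U ℓ) (hz : z ∈ U) (a : Fin n) :
    ∑ b, fundInv ℓ a b z * yLow ℓ b z = z.2 a := by
  simp only [yLow, Finset.mul_sum]
  rw [Finset.sum_comm]
  have : ∀ c, ∑ b, fundInv ℓ a b z * (fund ℓ b c z * z.2 c) = if a = c then z.2 c else 0 :=
    fun c => by
      rw [show (if a = c then z.2 c else 0) = (if a = c then 1 else 0) * z.2 c by
        split_ifs <;> simp, ← h.sum_fundInv_mul_fund hz, Finset.sum_mul]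
      exact Finset.sum_congr rfl fun b _ => by ring
  simp [this]

/-- At a point of vertical maximum of `f² / ℓ`, the equation `ℓ g^{ab} f_{·a·b} = (n - 2) f`
forces `f = 0`. -/
theorem IsFinslerOn.eq_zero_of_isMax (h : IsFinslerOn U ℓ) (hpos : ∀ z ∈ U, 0 < ℓ z)
    (hlor : ∀ z ∈ U, IsLorentzian (fundMatrix ℓ z)) (hf : ContDiffOn ℝ ∞ f U)
    (hfh : IsHomog U 1 f) (hz : z ∈ U)
    (heq : ℓ z * vertTrace ℓ f z = ((n : ℝ) - 2) * f z) {c : ℝ} (hc : f z ^ 2 = c * ℓ z)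
    (hmax : ∀ y, (z.1, y) ∈ U → f (z.1, y) ^ 2 ≤ c * ℓ (z.1, y)) : f z = 0 := by
  by_contra hfz
  have hℓ := hpos z hz
  have hc0 : 0 < c := by
    have : 0 < f z ^ 2 := by positivity
    rw [hc] at this
    exact pos_of_mul_pos_left this hℓ.le
  -- On the fibre `q ≤ 0`, with equality at `z`; using `q` avoids differentiating a quotient.
  set q : Eu n × Eu n → ℝ := fun w => f w * f w - c * ℓ w with hqdef
  have hq : ContDiffOn ℝ ∞ q U := (hf.mul hf).sub (contDiffOn_const.mul h.smooth)
  have hqh : IsHomog U 2 q := fun w hw r hr => by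
    have h1 := hfh w hw r hr
    have h2 := h.homog w hw r hr
    simp only [hqdef, h1, h2, zpow_one]
    rw [show r ^ (2 : ℤ) = r ^ 2 from by norm_cast]
    ring
  obtain ⟨hq1, hq2⟩ := dy_eq_zero_and_hessian_nonpos h.isOpen hq hz fun y hy => by
    have := hmax y hy
    simp only [hqdef]
    nlinarith
  have dq : ∀ a, Set.EqOn (dy a q) (fun w => 2 * (f w * dy a f w) - 2 * c * yLow ℓ a w) U :=
    fun a w hw => by
      have df := differentiableAt_of_contDiffOn h.isOpen hf hw
      have dℓ := differentiableAt_of_contDiffOn h.isOpen h.smooth hw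
      simp only [hqdef]
      rw [dy_sub (df.fun_mul df) (dℓ.const_mul c), dy_mul df df, dy_const_mul dℓ, h.yLow_eq a hw]
      ring
  have df := differentiableAt_of_contDiffOn h.isOpen hf hz
  have ddf := fun a => differentiableAt_of_contDiffOn h.isOpen (contDiffOn_dy h.isOpen hf a) hz
  have dy' := fun a => differentiableAt_of_contDiffOn h.isOpen (h.contDiffOn_yLow a) hz
  have ddq : ∀ a b, dy b (dy a q) z
      = 2 * (dy b f z * dy a f z + f z * dy b (dy a f) z) - 2 * c * fund ℓ a b z := fun a b => by
    rw [dy_congr h.isOpen (dq a) b hz, dy_sub ((df.fun_mul (ddf a)).const_mul 2)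
      ((dy' a).const_mul _), dy_const_mul (df.fun_mul (ddf a)), dy_mul df (ddf a),
      dy_const_mul (dy' a), h.dy_yLow hz]
  have hfa : ∀ a, f z * dy a f z = c * yLow ℓ a z := fun a => by
    have := (dq a hz).symm.trans (hq1 a)
    simp only at this
    linarith
  -- the trace of the Hessian
  have e1 : ∑ a, ∑ b, fundInv ℓ a b z * (dy b f z * dy a f z) = c := by
    have h1 : f z ^ 2 * ∑ a, ∑ b, fundInv ℓ a b z * (dy b f z * dy a f z) = c ^ 2 * ℓ z := by
      have h2 : ∀ a, f z ^ 2 * ∑ b, fundInv ℓ a b z * (dy b f z * dy a f z)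
          = c ^ 2 * (z.2 a * yLow ℓ a z) := fun a => by
        rw [← h.sum_fundInv_mul_yLow hz a, Finset.mul_sum, Finset.sum_mul, Finset.mul_sum]
        exact Finset.sum_congr rfl fun b _ => by
          linear_combination fundInv ℓ a b z * (f z * dy a f z * hfa b + c * yLow ℓ b z * hfa a)
      rw [Finset.mul_sum, Finset.sum_congr rfl fun a _ => h2 a, ← Finset.mul_sum,
        h.sum_snd_mul_yLow hz]
    rw [hc] at h1
    have : c * ℓ z ≠ 0 := by positivity
    apply mul_left_cancel₀ this
    linarith
  have e2 : f z * vertTrace ℓ f z = ((n : ℝ) - 2) * c := by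
    apply mul_left_cancel₀ hℓ.ne'
    linear_combination f z * heq + ((n : ℝ) - 2) * hc
  have e3 : ∑ a, ∑ b, fundInv ℓ a b z * fund ℓ a b z = n := by
    have : ∀ a, ∑ b, fundInv ℓ a b z * fund ℓ a b z = 1 := fun a => by
      rw [Finset.sum_congr rfl fun b _ => by rw [h.fund_comm hz a b], h.sum_fundInv_mul_fund hz,
        if_pos rfl]
    simp [this]
  -- The value is `2c + 2(n - 2)c - 2nc`.
  have htr : vertTrace ℓ q z = -2 * c := by
    have h1 : vertTrace ℓ q z = 2 * (∑ a, ∑ b, fundInv ℓ a b z * (dy b f z * dy a f z))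
        + 2 * (f z * vertTrace ℓ f z) - 2 * c * ∑ a, ∑ b, fundInv ℓ a b z * fund ℓ a b z := by
      simp only [vertTrace, ddq, Finset.mul_sum, ← Finset.sum_add_distrib, ← Finset.sum_sub_distrib]
      exact Finset.sum_congr rfl fun a _ => Finset.sum_congr rfl fun b _ => by ring
    rw [h1, e1, e2, e3]; ring
  have hy : z.2.ofLp ⬝ᵥ (fundMatrix ℓ z).mulVec z.2.ofLp = ℓ z := by
    rw [← h.sum_snd_mul_yLow hz]; rfl
  have hnn := (hlor z hz).trace_inv_mul_nonneg (h.isSymm_fundMatrix hz) (h.det_ne z hz)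
    (y := z.2) (by rw [hy]; exact hℓ) (Q := Matrix.of fun j i => dy j (dy i q) z)
    (fun v => by
      refine le_of_eq_of_le ?_ (hq2 (WithLp.toLp 2 v))
      simp only [dotProduct, Matrix.mulVec, Matrix.of_apply, Finset.mul_sum]
      rw [Finset.sum_comm]
      exact Finset.sum_congr rfl fun i _ => Finset.sum_congr rfl fun j _ => by ring)
    (by
      simp only [dotProduct, Matrix.mulVec, Matrix.of_apply, Finset.mul_sum]
      rw [Finset.sum_comm]
      -- Each `q_{·i}` has degree 1, so `y^j q_{·i·j} = q_{·i}`, which vanishes at the maximum.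
      refine Finset.sum_eq_zero fun i _ => ?_
      have := (hqh.dy h.isOpen h.conic hq i).euler
        (differentiableAt_of_contDiffOn h.isOpen (contDiffOn_dy h.isOpen hq i) hz) hz
      rw [hq1 i, mul_zero] at this
      rw [← mul_zero (z.2 i), ← this, Finset.mul_sum]
      exact Finset.sum_congr rfl fun j _ => by ring)
  have : ((fundMatrix ℓ z)⁻¹ * Matrix.of fun j i => dy j (dy i q) z).trace = vertTrace ℓ q z := rfl
  rw [this, htr] at hnn
  linarith

/-- If `f ≠ 0` somewhere on a fibre, the 0-homogeneous function `f² / ℓ` has a positive value there.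
As it tends to 0 at the nonzero boundary vectors, it attains a positive maximum on that fibre,
contrary to `eq_zero_of_isMax`. -/
theorem IsFinslerOn.eq_zero_of_mul_vertTrace (h : IsFinslerOn U ℓ) (hpos : ∀ z ∈ U, 0 < ℓ z)
    (hne : ∀ z ∈ U, z.2 ≠ 0)
    (hlor : ∀ z ∈ U, IsLorentzian (fundMatrix ℓ z)) (hf : ContDiffOn ℝ ∞ f U)
    (hfh : IsHomog U 1 f) (heq : ∀ z ∈ U, ℓ z * vertTrace ℓ f z = ((n : ℝ) - 2) * f z)
    (hbd : ∀ x y, y ≠ 0 → (x, y) ∉ U → y ∈ closure {y | (x, y) ∈ U} →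
      Filter.Tendsto (fun y => f (x, y) ^ 2 / ℓ (x, y)) (𝓝[{y | (x, y) ∈ U}] y) (𝓝 0)) :
    ∀ z ∈ U, f z = 0 := by
  rintro ⟨x, y₁⟩ hz₁
  by_contra hf₁
  set V : Set (Eu n) := {y | (x, y) ∈ U} with hV
  set w : Eu n → ℝ := fun y => f (x, y) ^ 2 / ℓ (x, y) with hw
  have hwpos : 0 < w y₁ := div_pos (by positivity) (hpos _ hz₁)
  have hwh : ∀ y ∈ V, ∀ c : ℝ, 0 < c → w (c • y) = w y := fun y hy c hc => by
    have h1 := hfh _ hy c hc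
    have h2 := h.homog _ hy c hc
    have h3 := (hpos _ hy).ne'
    simp only at h1 h2
    simp only [hw, h1, h2, zpow_one]
    rw [show c ^ (2 : ℤ) = c ^ 2 from by norm_cast]
    field_simp
  have hwc : ∀ y ∈ V, ContinuousAt w y := fun y hy => by
    have h1 : ContinuousAt (fun y : Eu n => (x, y)) y := by fun_prop
    have h2 : ContinuousAt f (x, y) := (hf.continuousOn).continuousAt (h.isOpen.mem_nhds hy)
    have h3 : ContinuousAt ℓ (x, y) := (h.smooth.continuousOn).continuousAt (h.isOpen.mem_nhds hy)
    exact ((ContinuousAt.comp (f := fun y : Eu n => (x, y)) h2 h1).pow 2).div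
      (ContinuousAt.comp (f := fun y : Eu n => (x, y)) h3 h1) (hpos _ hy).ne'
  have hnorm : ∀ y ∈ V, ‖y‖⁻¹ • y ∈ V ∩ Metric.sphere 0 1 ∧ w (‖y‖⁻¹ • y) = w y := fun y hy => by
    have h1 : ‖y‖ ≠ 0 := norm_ne_zero_iff.2 (hne _ hy)
    have h2 : 0 < ‖y‖⁻¹ := by positivity
    exact ⟨⟨h.conic _ hy _ h2, by simp [norm_smul, h1]⟩, hwh y hy _ h2⟩
  -- A superlevel set on the unit sphere of the chart. It cannot accumulate at the boundary of `V`,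
  -- where `w` tends to `0 < w y₁`, so it is compact.
  set K : Set (Eu n) := {y | y ∈ V ∩ Metric.sphere 0 1 ∧ w y₁ ≤ w y} with hK
  have hKV : K ⊆ V := fun y hy => hy.1.1
  have hKc : IsClosed K := by
    refine isClosed_of_closure_subset fun y hy => ?_
    have hys : y ∈ Metric.sphere (0 : Eu n) 1 :=
      closure_minimal (fun y hy => hy.1.2) Metric.isClosed_sphere hy
    have hy0 : y ≠ 0 := by rintro rfl; simp at hys
    have hnb : (𝓝[K] y).NeBot := mem_closure_iff_nhdsWithin_neBot.1 hy
    have hge : ∀ᶠ y' in 𝓝[K] y, w y₁ ≤ w y' := by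
      filter_upwards [self_mem_nhdsWithin] with y' hy' using hy'.2
    by_cases hyV : y ∈ V
    · exact ⟨⟨hyV, hys⟩, ge_of_tendsto ((hwc y hyV).mono_left nhdsWithin_le_nhds) hge⟩
    · have := ge_of_tendsto ((hbd x y hy0 hyV (closure_mono hKV hy)).mono_left
        (nhdsWithin_mono y hKV)) hge
      linarith
  have hKcpt : IsCompact K := (isCompact_sphere (0 : Eu n) 1).of_isClosed_subset hKc
    fun y hy => hy.1.2
  obtain ⟨y₀, hy₀, hmax⟩ := hKcpt.exists_isMaxOn
    ⟨_, (hnorm y₁ hz₁).1, (hnorm y₁ hz₁).2.ge⟩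
    (fun y hy => (hwc y (hKV hy)).continuousWithinAt)
  have hglob : ∀ y ∈ V, w y ≤ w y₀ := fun y hy => by
    by_cases hy1 : w y₁ ≤ w y
    · have := hmax (show ‖y‖⁻¹ • y ∈ K from ⟨(hnorm y hy).1, by rwa [(hnorm y hy).2]⟩)
      rwa [Set.mem_ofPred_eq, (hnorm y hy).2] at this
    · exact (not_le.1 hy1).le.trans hy₀.2
  have hz₀ : (x, y₀) ∈ U := hKV hy₀
  have h0 := h.eq_zero_of_isMax hpos hlor hf hfh hz₀ (heq _ hz₀) (c := w y₀)
    (by simp only [hw]; rw [div_mul_cancel₀ _ (hpos _ hz₀).ne'])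
    (fun y hy => (div_le_iff₀ (hpos _ hy)).1 (hglob y hy))
  have h1 : w y₀ = 0 := by simp [hw, h0]
  have := hy₀.2
  linarith

end MaximumPrinciple

/-! ### Boundary decay, and reduction of the affine equation. -/

section Vanishing

variable {n : ℕ} {W U : Set (Eu n × Eu n)} {ℓ ℓ' : Eu n × Eu n → ℝ} {z : Eu n × Eu n}
  {Z Z' : Fin n → Eu n × Eu n → ℝ}

/-- Solve the scalar equation for `f`, which is possible as `n ≠ 2`: then `f² / ℓ = ℓ (g^{ab}
f_{·a·b})² / (n - 2)²`. The trace is continuous up to the boundary point because `ℓ'`, its inverse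
fundamental tensor and `Z'` are smooth there, while `ℓ'` vanishes. -/
theorem IsVerticalSol.tendsto_boundary (hZ : IsVerticalSol W ℓ Z) (h : IsFinslerOn W ℓ)
    (hn : 3 ≤ n) (hpos : ∀ z ∈ W, 0 < ℓ z) {x y : Eu n} (hU : IsOpen U) (hxy : (x, y) ∈ U)
    (hℓ' : ContDiffOn ℝ ∞ ℓ' U) (hd' : ∀ z ∈ U, (fundMatrix ℓ' z).det ≠ 0)
    (hZ' : ∀ a, ContDiffOn ℝ ∞ (Z' a) U) (hℓ : Set.EqOn ℓ' ℓ (U ∩ W))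
    (hZZ : ∀ a, Set.EqOn (Z' a) (Z a) (U ∩ W)) (h0 : ℓ' (x, y) = 0) :
    Filter.Tendsto (fun y => vertDiv ℓ Z (x, y) ^ 2 / ℓ (x, y)) (𝓝[{y | (x, y) ∈ W}] y) (𝓝 0) := by
  have hO : IsOpen (U ∩ W) := hU.inter h.isOpen
  have hf := vertDiv_congr hO hℓ hZZ
  have hT := vertTrace_congr hO hℓ hf
  have sT := contDiffOn_vertTrace hU hℓ' hd' (contDiffOn_vertDiv hU hℓ' hd' hZ')
  have hn' : (n : ℝ) - 2 ≠ 0 := by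
    have : (3 : ℝ) ≤ n := by exact_mod_cast hn
    linarith
  set g : Eu n × Eu n → ℝ := fun z =>
    ℓ' z * (vertTrace ℓ' (vertDiv ℓ' Z') z) ^ 2 / ((n : ℝ) - 2) ^ 2 with hg
  have hgc : ContinuousAt g (x, y) :=
    ((hℓ'.continuousOn.continuousAt (hU.mem_nhds hxy)).mul
      ((sT.continuousOn.continuousAt (hU.mem_nhds hxy)).pow 2)).div_const _
  have hi : ContinuousAt (fun y : Eu n => (x, y)) y := by fun_prop
  have hlim : Filter.Tendsto (fun y => g (x, y)) (𝓝 y) (𝓝 0) := by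
    have : g (x, y) = 0 := by simp [hg, h0]
    rw [← this]
    exact ContinuousAt.comp (f := fun y : Eu n => (x, y)) hgc hi
  refine (hlim.mono_left nhdsWithin_le_nhds).congr' ?_
  filter_upwards [self_mem_nhdsWithin, nhdsWithin_le_nhds (hi.eventually_mem (hU.mem_nhds hxy))]
    with y' hy' hyU
  have hyW : (x, y') ∈ W := hy'
  have hm := hZ.mul_vertTrace h hyW
  have hp := (hpos _ hyW).ne'
  simp only [hg]
  rw [hℓ ⟨hyU, hyW⟩, hT ⟨hyU, hyW⟩, div_eq_div_iff (by positivity) hp]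
  linear_combination (ℓ (x, y') * vertTrace ℓ (vertDiv ℓ Z) (x, y')
    + ((n : ℝ) - 2) * vertDiv ℓ Z (x, y')) * hm

/-- With `f = 0`, `sum_fund_mul` gives `g_{ia} Z^a = 0`, and `g` is invertible. -/
theorem IsVerticalSol.eq_zero (hZ : IsVerticalSol W ℓ Z) (h : IsFinslerOn W ℓ)
    (hf : ∀ z ∈ W, vertDiv ℓ Z z = 0) (hz : z ∈ W) (a : Fin n) : Z a z = 0 := by
  have hdf : ∀ i, dy i (vertDiv ℓ Z) z = 0 := fun i => by
    rw [dy_congr h.isOpen (g := fun _ => 0) hf i hz, dy_zero]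
  have h1 : (fundMatrix ℓ z).mulVec (fun b => Z b z) = 0 := by
    funext i
    have h2 := hZ.sum_fund_mul h i hz
    simp only [hf z hz, hdf] at h2
    have h3 : (n : ℝ) + 2 ≠ 0 := by positivity
    simpa [h3, Matrix.mulVec, dotProduct, fundMatrix] using h2
  exact congrFun (Matrix.eq_zero_of_mulVec_eq_zero (h.det_ne z hz) h1) a

/-- The hypothesis reads `w_i y^j = (w · y) δ_i^j`. Its trace is `w · y = n (w · y)`, so `w · y =
0`; some `y^j ≠ 0` then gives `w = 0`. -/
theorem eq_zero_of_sum_mul_eq_zero (hn : 2 ≤ n) {w y : Fin n → ℝ} (hy : y ≠ 0)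
    (h : ∀ i j : Fin n, ∑ a, w a *
      ((if i = a then 1 else 0) * y j - y a * (if i = j then 1 else 0)) = 0) (i : Fin n) :
    w i = 0 := by
  have h1 : ∀ i j : Fin n, w i * y j = (∑ a, w a * y a) * if i = j then 1 else 0 := fun i j => by
    have := h i j
    simp only [mul_sub, Finset.sum_sub_distrib] at this
    rw [sub_eq_zero] at this
    rw [Finset.sum_mul]
    simpa [mul_assoc] using this
  have h2 : ∑ a, w a * y a = 0 := by
    have h3 : ∑ i, w i * y i = ∑ _i : Fin n, ∑ a, w a * y a :=
      Finset.sum_congr rfl fun i _ => by rw [h1 i i]; simp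
    rw [Finset.sum_const, Finset.card_univ, Fintype.card_fin, nsmul_eq_mul] at h3
    have h4 : (n : ℝ) - 1 ≠ 0 := by
      have : (2 : ℝ) ≤ n := by exact_mod_cast hn
      linarith
    apply mul_left_cancel₀ h4
    linarith
  obtain ⟨j, hj⟩ := Function.ne_iff.1 hy
  have := h1 i j
  rw [h2, zero_mul] at this
  exact (mul_eq_zero.1 this).resolve_right hj

/-- The affine equation for `J = ∂̇Z` together with `2 C_{a·i} Z^a + C_a Z^a_{·i} + Lan_i = 0`
amounts to the vertical equation. -/
theorem isVerticalSol_of_affineLHS (h : IsFinslerOn W ℓ) (hn : 2 ≤ n) (hpos : ∀ z ∈ W, 0 < ℓ z)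
    (hne : ∀ z ∈ W, z.2 ≠ 0) (hZ : ∀ a, ContDiffOn ℝ ∞ (Z a) W) (hZh : ∀ a, IsHomog W 2 (Z a))
    {J : Fin n → Fin n → Eu n × Eu n → ℝ} (hJ : ∀ i k, Set.EqOn (J i k) (dy i (Z k)) W)
    (haff : ∀ z ∈ W, ∀ i j, affineLHS ℓ J i j z = 0)
    (hK : ∀ z ∈ W, ∀ i, 2 * ∑ a, dy i (meanCartan ℓ a) z * Z a z
      + ∑ a, meanCartan ℓ a z * dy i (Z a) z + meanLandsberg ℓ i z = 0) :
    IsVerticalSol W ℓ Z where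
  smooth := hZ
  homog := hZh
  eq z hz i := by
    have hdJ : ∀ a i k, dy a (J i k) z = dy a (dy i (Z k)) z := fun a i k =>
      dy_congr h.isOpen (hJ i k) a hz
    have h1 : 2 * meanLandsberg ℓ i z + 2 * affineB ℓ J i z = 0 := by
      refine eq_zero_of_sum_mul_eq_zero (w := fun i => 2 * meanLandsberg ℓ i z
        + 2 * affineB ℓ J i z) (y := z.2.ofLp) hn ?_ (fun i j => ?_) i
      · intro h0
        exact hne z hz (by ext a; exact congrFun h0 a)
      · have := haff z hz i j
        -- The torsion term vanishes because second vertical derivatives of `Z^j` commute.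
        rw [affineLHS, Finset.sum_eq_zero (s := Finset.univ)
          (f := fun a => (dy a (J i j) z - dy i (J a j) z) * z.2 a), sub_zero] at this
        · exact this
        · intro a _
          rw [hdJ, hdJ, dy_comm h.isOpen (hZ j) hz, sub_self, zero_mul]
    have h2 : affineB ℓ J i z = ((n : ℝ) + 2) / 2 * ((∑ a, yLow ℓ a z * dy i (Z a) z) / ℓ z)
        - ∑ a, meanCartan ℓ a z * dy i (Z a) z - ∑ a, dy i (dy a (Z a)) z := by
      rw [affineB, Finset.sum_div, Finset.mul_sum (a := (1 / 2 : ℝ))]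
      congr 1
      · congr 1
        · exact congrArg _ (Finset.sum_congr rfl fun a _ => by rw [hJ i a hz]; ring)
        · exact Finset.sum_congr rfl fun a _ => by rw [hJ i a hz]
      · exact Finset.sum_congr rfl fun a _ => by
          rw [hdJ, hdJ, dy_comm h.isOpen (hZ a) hz a i]; ring
    have dZ := fun a => differentiableAt_of_contDiffOn h.isOpen (hZ a) hz
    have dC := fun a => differentiableAt_of_contDiffOn h.isOpen
      (contDiffOn_meanCartan h.isOpen h.smooth h.det_ne a) hz
    have ddZ := fun a => differentiableAt_of_contDiffOn h.isOpen
      (contDiffOn_dy h.isOpen (hZ a) a) hz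
    have h3 : dy i (vertDiv ℓ Z) z = 2 * (∑ a, dy i (meanCartan ℓ a) z * Z a z
        + ∑ a, meanCartan ℓ a z * dy i (Z a) z) + ∑ a, dy i (dy a (Z a)) z := by
      unfold vertDiv
      rw [dy_add ((DifferentiableAt.fun_sum fun a _ => (dC a).fun_mul (dZ a)).const_mul 2)
        (DifferentiableAt.fun_sum fun a _ => ddZ a),
        dy_const_mul (DifferentiableAt.fun_sum fun a _ => (dC a).fun_mul (dZ a)),
        dy_sum fun a _ => (dC a).fun_mul (dZ a), dy_sum fun a _ => ddZ a,
        ← Finset.sum_add_distrib]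
      congr 2
      exact Finset.sum_congr rfl fun a _ => dy_mul (dC a) (dZ a) i
    have h4 := hK z hz i
    have hp := (hpos z hz).ne'
    -- Substitute `Lan_i` from `hK` into `Lan_i + B_i = 0`: the remaining terms are exactly those of
    -- `f_{·i}` in `h3`.
    have h5 : ((n : ℝ) + 2) / 2 * ((∑ a, yLow ℓ a z * dy i (Z a) z) / ℓ z)
        = dy i (vertDiv ℓ Z) z := by
      rw [h3]; linarith
    rw [← h5]
    field_simp

end Vanishing

/-! ### Passage between `TM` and natural coordinates. -/

section Charts

variable {n : ℕ} {M : Type*} [TopologicalSpace M] [ChartedSpace (Eu n) M]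
  {e : OpenPartialHomeomorph M (Eu n)} {A : Set (TangentBundle (𝓡 n) M)}
  {L : TangentBundle (𝓡 n) M → ℝ}
  {Z : ∀ v : TangentBundle (𝓡 n) M, TangentSpace (𝓡 n) v.proj}

theorem ofCoord_smul (e : OpenPartialHomeomorph M (Eu n)) (z : Eu n × Eu n) (c : ℝ) :
    ofCoord e (z.1, c • z.2) = ⟨(ofCoord e z).proj, c • (ofCoord e z).snd⟩ :=
  Bundle.TotalSpace.ext rfl
    (heq_of_eq (map_smul (mfderiv (𝓡 n) (𝓡 n) e.symm z.1 : Eu n →L[ℝ] Eu n) c z.2))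

theorem mdifferentiable_of_mem_charts (he : e ∈ charts n M) :
    e.MDifferentiable (𝓡 n) (𝓡 n) :=
  ⟨(contMDiffOn_of_mem_maximalAtlas he).mdifferentiableOn (by simp),
    (contMDiffOn_symm_of_mem_maximalAtlas he).mdifferentiableOn (by simp)⟩

theorem IsHomogVectorField.isHomog_comp (hZ : IsHomogVectorField A 2 Z)
    (e : OpenPartialHomeomorph M (Eu n)) (i : Fin n) : IsHomog (coordSet e A) 2 (comp e Z i) := by
  intro z hz c hc
  -- `Z v` and `Z w` lie in different tangent spaces; both unfold to `Eu n`, where they can be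
  -- compared.
  have h1 : ∀ v w, v = w → (Z v : Eu n) = (Z w : Eu n) := by
    rintro v w rfl; rfl
  have h2 : (Z (ofCoord e (z.1, c • z.2)) : Eu n) = c ^ 2 • (Z (ofCoord e z) : Eu n) :=
    (h1 _ _ (ofCoord_smul e z c)).trans (hZ.homog _ hz.2 c hc)
  let T : Eu n →L[ℝ] Eu n := mfderiv (𝓡 n) (𝓡 n) e (e.symm z.1)
  have h3 : T (Z (ofCoord e (z.1, c • z.2))) = c ^ 2 • T (Z (ofCoord e z)) :=
    (congrArg T h2).trans (map_smul T _ _)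
  exact congrArg (fun u : Eu n => u i) h3

theorem ofCoord_snd_eq_zero_iff (he : e ∈ charts n M) {z : Eu n × Eu n} (hz : z.1 ∈ e.target) :
    (ofCoord e z).snd = 0 ↔ z.2 = 0 := by
  constructor
  · intro h
    have h1 := congrArg (fun T : Eu n →L[ℝ] Eu n => T z.2)
      ((mdifferentiable_of_mem_charts he).comp_symm_deriv hz)
    refine h1.symm.trans ?_
    refine (congrArg (mfderiv (𝓡 n) (𝓡 n) e (e.symm z.1)) h).trans (map_zero _)
  · intro h
    exact (congrArg (mfderiv (𝓡 n) (𝓡 n) e.symm z.1 : Eu n →L[ℝ] Eu n) h).trans (map_zero _)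

theorem exists_ofCoord_eq (he : e ∈ charts n M) (v : TangentBundle (𝓡 n) M)
    (hv : v.proj ∈ e.source) : ∃ z : Eu n × Eu n, z.1 ∈ e.target ∧ ofCoord e z = v := by
  refine ⟨(e v.proj, NormedSpace.fromTangentSpace _ (mfderiv (𝓡 n) (𝓡 n) e v.proj v.snd)),
    e.map_source hv, ?_⟩
  refine Bundle.TotalSpace.ext (e.left_inv hv) (heq_of_eq ?_)
  exact congrArg (fun T : Eu n →L[ℝ] Eu n => T v.snd)
    ((mdifferentiable_of_mem_charts he).symm_comp_deriv hv)

theorem eq_zero_of_comp_eq_zero (he : e ∈ charts n M) {z : Eu n × Eu n} (hz : z.1 ∈ e.target)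
    (h : ∀ i, comp e Z i z = 0) : Z (ofCoord e z) = 0 := by
  have h1 : mfderiv (𝓡 n) (𝓡 n) e (e.symm z.1) (Z (ofCoord e z)) = 0 := by
    refine PiLp.ext fun i => ?_
    exact h i
  have h2 := congrArg (fun T : Eu n →L[ℝ] Eu n => T (Z (ofCoord e z)))
    ((mdifferentiable_of_mem_charts he).symm_comp_deriv (e.map_target hz))
  refine h2.symm.trans ?_
  exact (congrArg (mfderiv (𝓡 n) (𝓡 n) e.symm (e (e.symm z.1))) h1).trans (map_zero _)

variable [IsManifold (𝓡 n) ∞ M]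

/-- Up to the identification of the model tangent bundle with a product, `ofCoord e` is the tangent
map of `e.symm`. -/
theorem continuousOn_ofCoord (he : e ∈ charts n M) :
    ContinuousOn (ofCoord e) {z | z.1 ∈ e.target} := by
  have h1 := (contMDiffOn_symm_of_mem_maximalAtlas he).continuousOn_tangentMapWithin (by simp)
    e.open_target.uniqueMDiffOn
  have h2 : Continuous (tangentBundleModelSpaceHomeomorph (𝓡 n)).symm :=
    (tangentBundleModelSpaceHomeomorph (𝓡 n)).symm.continuous
  have h3 : ContinuousOn (fun z : Eu n × Eu n => tangentMapWithin (𝓡 n) (𝓡 n) e.symm e.target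
      ((tangentBundleModelSpaceHomeomorph (𝓡 n)).symm z)) {z | z.1 ∈ e.target} :=
    h1.comp h2.continuousOn fun z hz => hz
  refine h3.congr fun z hz => ?_
  simp only [tangentMapWithin, ofCoord]
  congr 1
  exact congrArg (fun T : Eu n →L[ℝ] Eu n => T z.2)
    (mfderivWithin_of_isOpen (I := 𝓡 n) (I' := 𝓡 n) (f := e.symm) e.open_target hz).symm

theorem isOpen_coordSet (he : e ∈ charts n M) (hA : IsOpen A) : IsOpen (coordSet e A) :=
  (continuousOn_ofCoord he).isOpen_inter_preimage (e.open_target.preimage continuous_fst) hA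

theorem IsPseudoFinsler.isFinslerOn (hL : IsPseudoFinsler A L) (he : e ∈ charts n M) :
    IsFinslerOn (coordSet e A) (inCoord e L) where
  isOpen := isOpen_coordSet he hL.isOpen
  conic z hz c hc := ⟨hz.1, by rw [ofCoord_smul]; exact hL.smul_mem _ hz.2 c hc⟩
  smooth := hL.smooth e he
  homog z hz c hc := by
    rw [inCoord, ofCoord_smul, hL.homog _ hz.2 c hc]; norm_cast
  det_ne := hL.nondegenerate e he

/-- The maximum principle sees the boundary within one fibre, whereas properness concerns the
closure in `TM`; continuity of `y ↦ ofCoord e (x, y)` carries the first into the second. -/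
theorem mem_coordSet_bdry (he : e ∈ charts n M) {x y : Eu n} (hy : y ≠ 0)
    (hxy : (x, y) ∉ coordSet e A) (hcl : y ∈ closure {y | (x, y) ∈ coordSet e A}) :
    (x, y) ∈ coordSet e (bdry A) := by
  obtain ⟨y', hy'⟩ := closure_nonempty_iff.1 ⟨y, hcl⟩
  have hx : x ∈ e.target := hy'.1
  have hc : ContinuousAt (ofCoord e) (x, y) := (continuousOn_ofCoord he).continuousAt
    ((e.open_target.preimage continuous_fst).mem_nhds hx)
  have hi : ContinuousAt (fun y : Eu n => (x, y)) y := by fun_prop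
  refine ⟨hx, ⟨?_, fun h => hy ((ofCoord_snd_eq_zero_iff he hx).1 h)⟩, fun h => hxy ⟨hx, h⟩⟩
  exact (ContinuousAt.comp (f := fun y : Eu n => (x, y)) hc hi).continuousWithinAt.mem_closure hcl
    fun y hy => hy.2

/-- The components of a vector field `Z` such that `N^L + ∂̇Z` extends smoothly also extend
smoothly, together with the metric. -/
theorem exists_extension (hL : IsProper A L) (hZ : IsHomogVectorField A 2 Z)
    {N : NonlinearConnection A} (hN : N.EqMetricAdd L Z) (hext : N.ExtendsSmoothly)
    (he : e ∈ charts n M) {z : Eu n × Eu n} (hz : z ∈ coordSet e (bdry A)) :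
    ∃ (U : Set (Eu n × Eu n)) (ℓ' : Eu n × Eu n → ℝ) (Z' : Fin n → Eu n × Eu n → ℝ),
      IsOpen U ∧ z ∈ U ∧ ContDiffOn ℝ ∞ ℓ' U ∧ (∀ z ∈ U, (fundMatrix ℓ' z).det ≠ 0) ∧
      (∀ a, ContDiffOn ℝ ∞ (Z' a) U) ∧ Set.EqOn ℓ' (inCoord e L) (U ∩ coordSet e A) ∧
      (∀ a, Set.EqOn (Z' a) (comp e Z a) (U ∩ coordSet e A)) ∧ ℓ' z = 0 := by
  obtain ⟨U₁, ℓ', hU₁, hz₁, sℓ, hℓ, h0, hdet⟩ := hL.boundary e he z hz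
  obtain ⟨U₂, F, hU₂, hz₂, sF, hF⟩ := hext e he z hz
  have hfin := hL.isFinslerOn he
  -- Nondegeneracy is given only at `z`; by continuity it persists on a smaller neighbourhood.
  set U : Set (Eu n × Eu n) := (U₁ ∩ (fun z => (fundMatrix ℓ' z).det) ⁻¹' {0}ᶜ) ∩ U₂ with hUdef
  have hU : IsOpen U := ((contDiffOn_det_fundMatrix hU₁ sℓ).continuousOn.isOpen_inter_preimage hU₁
    isOpen_compl_singleton).inter hU₂
  have hd : ∀ z ∈ U, (fundMatrix ℓ' z).det ≠ 0 := fun z hz => hz.1.2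
  have sℓU : ContDiffOn ℝ ∞ ℓ' U := sℓ.mono fun z hz => hz.1.1
  have hℓU : Set.EqOn ℓ' (inCoord e L) (U ∩ coordSet e A) :=
    hℓ.mono fun w hw => (⟨hw.1.1.1, hw.2⟩ : w ∈ U₁ ∩ coordSet e A)
  -- Euler's identity recovers `Z` from its derivatives: `2 Z^k = y^i Z^k_{·i} = y^i (N - N^L)_i^k`,
  -- and the right-hand side extends.
  refine ⟨U, ℓ', fun k z => 1 / 2 * ∑ i, z.2 i * (F z (EuclideanSpace.single i 1) k
    - metricConn ℓ' i k z), hU, ⟨⟨hz₁, hdet⟩, hz₂⟩, sℓU, hd, fun k => ?_, hℓU, fun k w hw => ?_, h0⟩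
  · refine contDiffOn_const.mul (ContDiffOn.sum fun i _ => (contDiff_snd_apply i).contDiffOn.mul
      (ContDiffOn.sub ?_ (contDiffOn_metricConn hU sℓU hd i k)))
    exact (EuclideanSpace.proj k : Eu n →L[ℝ] ℝ).contDiff.comp_contDiffOn
      ((sF.mono fun z hz => hz.2).clm_apply contDiffOn_const)
  · have h1 := (hZ.isHomog_comp e k).euler (differentiableAt_of_contDiffOn hfin.isOpen
      (hZ.smooth e he k) hw.2) hw.2
    have h2 : ∀ i, F w (EuclideanSpace.single i 1) k - metricConn ℓ' i k w
        = dy i (comp e Z k) w := fun i => by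
      have h3 := hN e he w hw.2 i k
      rw [NonlinearConnection.coef] at h3
      rw [hF ⟨hw.1.2, hw.2⟩, h3, metricConn_congr (hU.inter hfin.isOpen) hℓU i k hw]
      ring
    simp only [h2, h1]
    push_cast
    ring

end Charts

end AnisoFinsler

end

/-! ### The theorem, proved chart by chart. -/

theorem mainTheorem7 (n : ℕ) (hn : 3 ≤ n)
    {M : Type*} [TopologicalSpace M] [T2Space M] [SecondCountableTopology M] [ConnectedSpace M]
    [ChartedSpace (AnisoFinsler.Eu n) M] [IsManifold (𝓡 n) ∞ M]
    (A : Set (TangentBundle (𝓡 n) M)) (L : TangentBundle (𝓡 n) M → ℝ)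
    (hL : AnisoFinsler.IsLorentzFinsler A L)
    (Z : ∀ v : TangentBundle (𝓡 n) M, TangentSpace (𝓡 n) v.proj)
    (hZ : AnisoFinsler.IsHomogVectorField A 2 Z)
    (N : AnisoFinsler.NonlinearConnection A) (hN : N.EqMetricAdd L Z)
    (hsol : N ∈ AnisoFinsler.SolSym A L ∩ AnisoFinsler.SolProper A L)
    (hK : ∀ e ∈ AnisoFinsler.charts n M, ∀ z ∈ AnisoFinsler.coordSet e A, ∀ i : Fin n,
      2 * ∑ a, AnisoFinsler.dy i (AnisoFinsler.meanCartan (AnisoFinsler.inCoord e L) a) z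
            * AnisoFinsler.comp e Z a z
        + ∑ a, AnisoFinsler.meanCartan (AnisoFinsler.inCoord e L) a z
            * AnisoFinsler.dy i (AnisoFinsler.comp e Z a) z
        + AnisoFinsler.meanLandsberg (AnisoFinsler.inCoord e L) i z = 0) :
    (∀ v ∈ A, Z v = 0) ∧
      ∀ e ∈ AnisoFinsler.charts n M, ∀ z ∈ AnisoFinsler.coordSet e A, ∀ i : Fin n,
        AnisoFinsler.meanLandsberg (AnisoFinsler.inCoord e L) i z = 0 := by
  have hcomp : ∀ e ∈ AnisoFinsler.charts n M, ∀ a,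
      Set.EqOn (AnisoFinsler.comp e Z a) (fun _ => 0) (AnisoFinsler.coordSet e A) := by
    intro e he a z hz
    have hfin := hL.isFinslerOn he
    have hpos : ∀ z ∈ AnisoFinsler.coordSet e A, 0 < AnisoFinsler.inCoord e L z :=
      fun z hz => hL.pos _ hz.2
    have hne : ∀ z ∈ AnisoFinsler.coordSet e A, z.2 ≠ 0 := fun z hz h =>
      hL.ne_zero _ hz.2 ((AnisoFinsler.ofCoord_snd_eq_zero_iff he hz.1).2 h)
    have hsm := hZ.smooth e he
    have hV : AnisoFinsler.IsVerticalSol (AnisoFinsler.coordSet e A) (AnisoFinsler.inCoord e L)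
        (AnisoFinsler.comp e Z) :=
      AnisoFinsler.isVerticalSol_of_affineLHS hfin (by omega) hpos hne hsm (hZ.isHomog_comp e)
        (J := N.diffMetric L e)
        (fun i k z hz => by
          rw [AnisoFinsler.NonlinearConnection.diffMetric, hN e he z hz i k]; ring)
        (hsol.2.1 e he) (hK e he)
    refine hV.eq_zero hfin ?_ hz a
    refine hfin.eq_zero_of_mul_vertTrace hpos hne (hL.lorentzian e he)
      (hfin.contDiffOn_vertDiv hsm) (hfin.homog_vertDiv hsm (hZ.isHomog_comp e))
      (fun z hz => hV.mul_vertTrace hfin hz) fun x y hy hxy hcl => ?_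
    obtain ⟨U, ℓ', Z', hU, hzU, sℓ, hd, sZ, hℓ, hZZ, h0⟩ := AnisoFinsler.exists_extension
      hL.toIsProper hZ hN hsol.2.2 he (AnisoFinsler.mem_coordSet_bdry he hy hxy hcl)
    exact hV.tendsto_boundary hfin hn hpos hU hzU sℓ hd sZ hℓ hZZ h0
  refine ⟨fun v hv => ?_, fun e he z hz i => ?_⟩
  · have he : chartAt (AnisoFinsler.Eu n) v.proj ∈ AnisoFinsler.charts n M :=
      IsManifold.chart_mem_maximalAtlas v.proj
    obtain ⟨z, hz, hzv⟩ := AnisoFinsler.exists_ofCoord_eq he v (mem_chart_source _ _)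
    have h := AnisoFinsler.eq_zero_of_comp_eq_zero he hz
      fun i => hcomp _ he i ⟨hz, Set.mem_of_eq_of_mem hzv hv⟩
    rwa [hzv] at h
  -- Once `Z` vanishes on the open set `coordSet e A`, so do its derivatives, and only `Lan_i` is
  -- left in `hK`.
  · have h1 := hK e he z hz i
    have h2 : ∀ a, AnisoFinsler.dy i (AnisoFinsler.comp e Z a) z = 0 := fun a => by
      rw [AnisoFinsler.dy_congr (AnisoFinsler.isOpen_coordSet he hL.isOpen) (hcomp e he a) i hz,
        AnisoFinsler.dy_zero]
    simpa [hcomp e he _ hz, h2] using h1
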